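/- **Setting.** Let $(\mathcal S,\mathcal A,\mathcal P,c,\gamma)$ be a finite Markov decision process with $|\mathcal A|\ge 2$, costs $0\le c\le 1$, and $\gamma\in(0,1)$. For a randomized stationary policy $\pi$ let $V^\pi(s)=\mathbb E\big[\sum_{t\ge0}\gamma^t c(S_t,A_t)\mid S_0=s\big]$, where $A_t\sim\pi(\cdot|S_t)$ and $S_{t+1}\sim\mathcal P(\cdot|S_t,A_t)$. For a distribution $\vartheta$ on $\mathcal S$ let $f(\pi)=f_\vartheta(\pi)=\mathbb E_{s\sim\vartheta}V^\pi(s)$. Let $\pi^*$ be an optimal policy, that is, $V^{\pi^*}(s)\le V^\pi(s)$ for all $s$ and all policies $\pi$. Put $M=1/(1-\gamma)$ and $|\mathcal Z|=|\mathcal S||\mathcal A|$. **Algorithm (SPMD with multi-trajectory TOMC).** Let $$D(x,y)=-\sum_a x_a^{1/2}+\tfrac12\sum_a y_a^{1/2}+\tfrac12\sum_a x_a y_a^{-1/2}$$ be the Tsallis divergence of index $1/2$ on the simplex $\Delta_{\mathcal A}$. Let $\pi_0(\cdot|s)$ be uniform. At iteration $t=0,\dots,k-1$ draw $m$ trajectories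 $Z_0,\dots,Z_{n-1}$ of state-action pairs following $\pi_t$. Their initial pairs are arbitrary (possibly random, and dependent on everything sampled before); given these pairs the trajectories are independent. The single-trajectory estimate at $z=(s,a)$ is $\sum_{j=\tau(z)}^{n-1}\gamma^{j-\tau(z)}c(Z_j)$, where $\tau(z)$ is the first visit time to $z$, and it is $0$ if $z$ is not visited. Let $\hat Q_t(s,a)$ be the average of the $m$ single-trajectory estimates if $\pi_t(a|s)\ge\tau$, and $\hat Q_t(s,a)=1/(1-\gamma)$ if $\pi_t(a|s)<\tau$. Then $$\pi_{t+1}(\cdot|s)=\operatorname*{argmin}_{x\in\Delta_{\mathcal A}}\ \eta\langle\hat Q_t(s,\cdot),x\rangle+D(x,\pi_t(\cdot|s))\qquad\text{for every } s.$$ The run uses $k\,m\,n$ samples. **Assumption.** There are constants $C>0$, $\rho\in(0,1)$, $\underline\nu>0$ such that, almost surely, for each generated policy $\pi_i$, $i\le k$, the state chain has a stationary distribution $\nu^{\pi_i}$ with $\min_s\nu^{\pi_i}(s)\ge\underline\nu$ and $\sum_s|\mathbb P^{\pi_i}(S_t=s|S_0=s_0)-\nu^{\pi_i}(s)|\le C\rho^{t+1}$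 for all $s_0\in\mathcal S$ and $t\ge0$. **Parameters.** For $k\ge1$ and $\delta\in(0,1)$ set $$\eta=\sqrt{\frac{|\mathcal A|^{1/2}-1}{8|\mathcal A|kM^2}},\qquad \tau=\Big(\frac{4}{1-\gamma}\Big)^{-2}|\mathcal A|^{-1},\qquad \varepsilon=M\sqrt{\frac{2|\mathcal A|(|\mathcal A|^{1/2}-1)}{k}},$$ $$t_{\rm mix}=\max\Big\{1,\Big\lceil\log_\rho\frac{\underline\nu(1-\gamma)^2}{32C|\mathcal A|}\Big\rceil\Big\},\qquad L=\frac1{1-\gamma}+\frac{t_{\rm mix}|\mathcal A|}{\underline\nu(1-\gamma)^2},$$ $$\mathsf m=\frac{|\mathcal A|^2}{(1-\gamma)^2\varepsilon^2}\log\frac{2|\mathcal Z|k}{\delta},\qquad \mathsf n=L\log\frac{|\mathcal A|}{\varepsilon}.$$ **Proposition (SPMD with Tsallis divergence).** There are absolute constants $c_0>0$ and $q\in\mathbb N$ such that the following holds under the assumption above. 1. If $m,n\ge1$ satisfy $m\ge c_0\,\mathsf m$ and $n\ge c_0\,\mathsf n\,(\log(e+\mathsf n))^q$, then with probability at least $1-\delta$,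 simultaneously for all $\vartheta$, $$\min_{0\le t\le k-1}f(\pi_t)-f(\pi^*)\le\frac{12M}{1-\gamma}\sqrt{\frac{|\mathcal A|^{3/2}}{k}}.$$ 2. There are absolute constants $K>0$ and $r\in\mathbb N$ such that for every target accuracy $\epsilon\in(0,1]$, taking $k=\lceil144|\mathcal A|^{3/2}/((1-\gamma)^4\epsilon^2)\rceil$, $m=\lceil c_0\mathsf m\rceil$ and $n=\lceil c_0\mathsf n(\log(e+\mathsf n))^q\rceil$, one has $\min_{0\le t\le k-1}f(\pi_t)-f(\pi^*)\le\epsilon$ simultaneously for all $\vartheta$ with probability at least $1-\delta$, and the number of samples satisfies $k\,m\,n\le K F(\log(e+F))^r$, where $$F=\frac{|\mathcal A|^{7/2}}{(1-\gamma)^8\epsilon^4}\Big(\frac1{1-\gamma}+\frac{t_{\rm mix}|\mathcal A|}{\underline\nu(1-\gamma)^2}\Big)\log\Big(\frac{288|\mathcal Z||\mathcal A|^{3/2}}{\delta(1-\gamma)^4\epsilon^2}\Big)\log\frac{|\mathcal A|}{\epsilon}.$$ -/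

import Mathlib

open scoped BigOperators Matrix

universe u v

noncomputable section

namespace SPMD

/-- A finite discounted Markov decision process with costs in `[0, 1]` and discount factor in
`(0, 1)`. -/
structure MDP (S : Type u) (A : Type v) where
  P : S → A → PMF S
  c : S → A → ℝ
  γ : ℝ
  c_nonneg : ∀ s a, 0 ≤ c s a
  c_le_one : ∀ s a, c s a ≤ 1
  γ_pos : 0 < γ
  γ_lt_one : γ < 1

/-- Randomized stationary policies. -/
abbrev Policy (S : Type u) (A : Type v) := S → PMF A

/-- A batch of `m` trajectories, each consisting of `n` state-action pairs `Z_0, …, Z_{n-1}`. -/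
abbrev Batch (S : Type u) (A : Type v) (m n : ℕ) := Fin m → Fin n → S × A

section Values

variable {S : Type u} {A : Type v} [Fintype S] [DecidableEq S] [Fintype A]

/-- Transition matrix of the state chain: `P^π(s' | s) = ∑ₐ π(a|s) P(s'|s,a)` in entry `(s, s')`. -/
def transition (M : MDP S A) (π : Policy S A) : Matrix S S ℝ :=
  fun s s' => ∑ a, (π s a).toReal * (M.P s a s').toReal

/-- Value function `V^π(s) = ∑_t γ^t E[c(S_t, A_t) | S_0 = s]`; entry `(s, s')` of the `t`-th
power of the transition matrix is the probability of `S_t = s'` given `S_0 = s`. -/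
def value (M : MDP S A) (π : Policy S A) (s : S) : ℝ :=
  ∑' t : ℕ, M.γ ^ t *
    ∑ s', (transition M π ^ t) s s' * ∑ a, (π s' a).toReal * M.c s' a

/-- The objective `f(π) = E_{s ∼ ϑ} V^π(s)`. -/
def objective (M : MDP S A) (ϑ : PMF S) (π : Policy S A) : ℝ :=
  ∑ s, (ϑ s).toReal * value M π s

def IsOptimal (M : MDP S A) (π : Policy S A) : Prop :=
  ∀ (π' : Policy S A) (s : S), value M π s ≤ value M π' s

/-- The state chain of `π` has a stationary distribution `ν` with all masses at least `νmin`, and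
from every initial state the law of `S_t` is within `C ρ^(t+1)` of `ν` in `ℓ₁`-distance. -/
def IsMixing (M : MDP S A) (C ρ νmin : ℝ) (π : Policy S A) : Prop :=
  ∃ ν : PMF S,
    (∀ s, (ν s).toReal = ∑ s', (ν s').toReal * transition M π s' s) ∧
    (∀ (s₀ : S) (t : ℕ), ∑ s, |(transition M π ^ t) s₀ s - (ν s).toReal| ≤ C * ρ ^ (t + 1)) ∧
    ∀ s, νmin ≤ (ν s).toReal

end Values

section Sampling

variable {S : Type u} {A : Type v}

/-- One step of the state-action chain: `S' ∼ P(·|s,a)`, then `A' ∼ π(·|S')`. -/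
def step (M : MDP S A) (π : Policy S A) (z : S × A) : PMF (S × A) :=
  (M.P z.1 z.2).bind fun s' => (π s').map fun a' => (s', a')

/-- Law of a trajectory `Z_0, …, Z_{n-1}` of the state-action chain of `π` with `Z_0 = z`. -/
def trajLaw (M : MDP S A) (π : Policy S A) : (n : ℕ) → S × A → PMF (Fin n → S × A)
  | 0, _ => PMF.pure Fin.elim0
  | n + 1, z => (step M π z).bind fun z' =>
      (trajLaw M π n z').map fun x => (Fin.cons z x : Fin (n + 1) → S × A)

/-- Law of `m` independent trajectories of length `n` with the given initial pairs. -/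
def batchLaw (M : MDP S A) (π : Policy S A) (n : ℕ) :
    (m : ℕ) → (Fin m → S × A) → PMF (Batch S A m n)
  | 0, _ => PMF.pure Fin.elim0
  | m + 1, z => (trajLaw M π n (z 0)).bind fun x =>
      (batchLaw M π n m (Fin.tail z)).map fun b => (Fin.cons x b : Batch S A (m + 1) n)

/-- First time at which the trajectory visits `z`, and `n` if it does not. -/
def hitTime {n : ℕ} (x : Fin n → S × A) (z : S × A) : ℕ :=
  sInf ({t | ∃ h : t < n, x ⟨t, h⟩ = z} ∪ {n})

/-- First-visit Monte-Carlo estimate of `Q^π(z)` from a single trajectory (`0` without visit). -/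
def omcSingle (M : MDP S A) {n : ℕ} (x : Fin n → S × A) (z : S × A) : ℝ :=
  ∑ t : Fin n, if hitTime x z ≤ (t : ℕ) then
    M.γ ^ ((t : ℕ) - hitTime x z) * M.c (x t).1 (x t).2 else 0

/-- On-policy Monte-Carlo: average of the single-trajectory estimates. -/
def omc (M : MDP S A) {m n : ℕ} (b : Batch S A m n) (s : S) (a : A) : ℝ :=
  (1 / (m : ℝ)) * ∑ l, omcSingle M (b l) (s, a)

/-- Truncated on-policy Monte-Carlo with threshold `τ`. -/
def tomc (M : MDP S A) (τ : ℝ) (π : Policy S A) {m n : ℕ} (b : Batch S A m n)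
    (s : S) (a : A) : ℝ :=
  if τ ≤ (π s a).toReal then omc M b s a else 1 / (1 - M.γ)

end Sampling

section Algorithm

variable {S : Type u} {A : Type v} [Fintype A]

/-- Tsallis divergence with index `p` of `x` from `y`: the Bregman divergence of
`w(x) = -∑ₐ x(a)^p`. -/
def tsallisDiv (p : ℝ) (x y : PMF A) : ℝ :=
  -(∑ a, (x a).toReal ^ p) + (1 - p) * ∑ a, (y a).toReal ^ p
    + p * ∑ a, (x a).toReal * (y a).toReal ^ (p - 1)

/-- Objective of the mirror descent step at one state, for the Tsallis divergence of index `1/2`. -/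
def stepObjective (η : ℝ) (Q : A → ℝ) (y x : PMF A) : ℝ :=
  η * ∑ a, Q a * (x a).toReal + tsallisDiv (1 / 2) x y

open Classical in
/-- The mirror descent step `argmin_x { η ⟨Q, x⟩ + D(x, y) }` over the simplex. For `y` with full
support the minimizer exists and is unique; the fallback branch only makes the function total. -/
def mirrorStep (η : ℝ) (Q : A → ℝ) (y : PMF A) : PMF A :=
  if h : ∃ x : PMF A, ∀ x' : PMF A, stepObjective η Q y x ≤ stepObjective η Q y x' then
    h.choose
  else y

variable [Nonempty A]

/-- The policy obtained from the uniform policy after SPMD has processed the batches in `h`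
(in chronological order). On a run `h`, the iterate `π_t` is `policyAfter M η τ (h.take t)`. -/
def policyAfter (M : MDP S A) (η τ : ℝ) {m n : ℕ} (h : List (Batch S A m n)) : Policy S A :=
  h.foldl (fun π b s => mirrorStep η (tomc M τ π b s) (π s))
    (fun _ => PMF.uniformOfFintype A)

/-- Joint law of the batches of the first `k` iterations of SPMD with multi-trajectory TOMC.
In each iteration the initial pairs of the `m` trajectories are produced by the rule `init`, which
may depend on everything sampled before; given these pairs, the trajectories are independent and
follow the current policy. -/
def runLaw (M : MDP S A) (η τ : ℝ) {m n : ℕ}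
    (init : List (Batch S A m n) → PMF (Fin m → S × A)) : ℕ → PMF (List (Batch S A m n))
  | 0 => PMF.pure []
  | k + 1 => (runLaw M η τ init k).bind fun h =>
      ((init h).bind fun z => batchLaw M (policyAfter M η τ h) n m z).map fun b => h ++ [b]

end Algorithm

section Runs

variable {S : Type u} {A : Type v} [Fintype S] [DecidableEq S] [Fintype A] [Nonempty A]

/-- Almost surely, all policies `π_0, …, π_k` generated by the run are mixing and exploring over
the states with the common constants `(C, ρ, νmin)`. -/
def UniformlyMixing (M : MDP S A) (η τ : ℝ) {m n : ℕ}
    (init : List (Batch S A m n) → PMF (Fin m → S × A)) (k : ℕ) (C ρ νmin : ℝ) : Prop :=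
  ∀ h ∈ (runLaw M η τ init k).support, ∀ i ≤ k,
    IsMixing M C ρ νmin (policyAfter M η τ (h.take i))

/-- The event that `min_{0 ≤ t ≤ k-1} f(π_t) - f(π*) ≤ B`, simultaneously for all weights `ϑ` in
the objective `f`. -/
def gapEvent (M : MDP S A) (η τ : ℝ) {m n : ℕ} (k : ℕ) (πs : Policy S A) (B : ℝ) :
    Set (List (Batch S A m n)) :=
  {h | ∀ ϑ : PMF S,
    (⨅ t : Fin k, objective M ϑ (policyAfter M η τ (h.take t))) - objective M ϑ πs ≤ B}

end Runs

section Parameters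

/-- The stepsize `√((|A|^{1/2} - 1) / (8 |A| k M²))` with `M = 1/(1-γ)`. -/
def stepsize (γ : ℝ) (cardA k : ℕ) : ℝ :=
  √((√(cardA : ℝ) - 1) / (8 * cardA * k * (1 / (1 - γ)) ^ 2))

/-- The truncation threshold `(4/(1-γ))^{-2} |A|^{-1}`. -/
def threshold (γ : ℝ) (cardA : ℕ) : ℝ := ((4 / (1 - γ)) ^ 2)⁻¹ * (cardA : ℝ)⁻¹

/-- The noise level `ε = M √(2 |A| (|A|^{1/2} - 1) / k)` with `M = 1/(1-γ)`. -/
def noiseLevel (γ : ℝ) (cardA k : ℕ) : ℝ :=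
  1 / (1 - γ) * √(2 * cardA * (√(cardA : ℝ) - 1) / k)

/-- The mixing time `⌈log_ρ (νmin (1-γ)² / (32 C |A|))⌉`, taken to be at least one step. (With two
or more states the ceiling of a mixing chain is at least one anyway.) -/
def mixTime (γ C ρ νmin : ℝ) (cardA : ℕ) : ℕ :=
  max 1 ⌈Real.logb ρ (νmin * (1 - γ) ^ 2 / (32 * C * cardA))⌉₊

/-- `1/(1-γ) + t_mix |A| / (νmin (1-γ)²)`. -/
def horizonFactor (γ C ρ νmin : ℝ) (cardA : ℕ) : ℝ :=
  1 / (1 - γ) + mixTime γ C ρ νmin cardA * cardA / (νmin * (1 - γ) ^ 2)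

/-- Order of the number of trajectories: `|A|² / ((1-γ)² ε²) log (2 |S||A| k / δ)`. -/
def mScale (γ δ : ℝ) (cardS cardA k : ℕ) : ℝ :=
  (cardA : ℝ) ^ 2 / ((1 - γ) ^ 2 * noiseLevel γ cardA k ^ 2)
    * Real.log (2 * (cardS * cardA) * k / δ)

/-- Order of the trajectory length, up to logarithmic factors. -/
def nScale (γ C ρ νmin : ℝ) (cardA k : ℕ) : ℝ :=
  horizonFactor γ C ρ νmin cardA * Real.log (cardA / noiseLevel γ cardA k)

/-- Order of the number of samples for accuracy `ε`, up to logarithmic factors. -/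
def sampleScale (γ δ ε C ρ νmin : ℝ) (cardS cardA : ℕ) : ℝ :=
  (cardA : ℝ) ^ (7 / 2 : ℝ) / ((1 - γ) ^ 8 * ε ^ 4)
    * horizonFactor γ C ρ νmin cardA
    * Real.log (288 * (cardS * cardA) * (cardA : ℝ) ^ (3 / 2 : ℝ) / (δ * (1 - γ) ^ 4 * ε ^ 2))
    * Real.log (cardA / ε)

/-- `x · log(e + x)^q`: soft-order notation is an absolute constant times this, for an absolute
exponent `q`. -/
def polylog (q : ℕ) (x : ℝ) : ℝ := x * Real.log (Real.exp 1 + x) ^ q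

/-- The number of iterations `⌈144 |A|^{3/2} / ((1-γ)⁴ ε²)⌉` for accuracy `ε`. -/
def iterationCount (γ ε : ℝ) (cardA : ℕ) : ℕ :=
  ⌈144 * (cardA : ℝ) ^ (3 / 2 : ℝ) / ((1 - γ) ^ 4 * ε ^ 2)⌉₊

end Parameters

end SPMD

end

/-! Mirror descent is run here with estimates that may be badly wrong on rarely played actions; the
point is that this does no harm. Fix a deterministic greedy comparator σ for π*. Weighting states by
the discounted occupancy of σ bounds the value gap by a sum of advantages V(s') - Q(s', σ(s'))
(`exists_weight`). A mirror step pays for each advantage by decreasing the divergence from the point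
mass at σ(s') to π_t(·|s'), up to 2η²M² and an estimation error (`one_step_gap`).

A truncated action gets the maximal cost M, which only overestimates Q, so truncation could hurt
only at σ(s) itself. That never happens: the Tsallis divergence from the point mass at a dominates
π(a)^{-1/2}/2 - 1, and because all gaps are nonnegative by optimality, the weighted divergence
exceeds its initial value M(√|A| - 1) by at most the accumulated errors. `sum_gap_le` closes this
circle by one induction: the potential bound at time t excludes truncation of σ at time t, which
gives the potential bound at time t + 1.

On untruncated pairs the first-visit estimate underestimates in mean, by at most M times the
expectation of γ to the number of steps left after the first visit (`qValue_le_expect_omcSingle`).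
Mixing makes every such pair reachable within t_mix steps with a uniform probability, so this bias
decays exponentially in n (`missWeight_le_exp`). A Chernoff bound and union bounds over pairs and
iterations (`expect_batchLaw_not_accurate_le`, `toOuterMeasure_badRun_le`) make all estimates
ε/4-accurate with probability 1 - δ. If k is so small that the claimed rate exceeds M, there is
nothing to prove; otherwise ε ≤ 1/8 and the logarithms are under control. The sample count is then
arithmetic. -/

noncomputable section

namespace SPMD

/-! ### Real-valued expectations on finite types -/

section Expectation

variable {α β : Type*} [Fintype α] [Fintype β]

/-- Expectation of a real function under a probability mass function on a finite type. -/
def expect (p : PMF α) (f : α → ℝ) : ℝ := ∑ x, (p x).toReal * f x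

lemma sum_toReal (p : PMF α) : ∑ x, (p x).toReal = 1 := by
  rw [← ENNReal.toReal_sum (fun a _ => p.apply_ne_top a), ← tsum_fintype (L := .unconditional α),
    p.tsum_coe, ENNReal.toReal_one]

lemma toReal_le_one (p : PMF α) (x : α) : (p x).toReal ≤ 1 := by
  rw [← sum_toReal p]
  exact Finset.single_le_sum (f := fun x => (p x).toReal) (fun _ _ => ENNReal.toReal_nonneg)
    (Finset.mem_univ x)

lemma expect_const (p : PMF α) (c : ℝ) : expect p (fun _ => c) = c := by
  rw [expect, ← Finset.sum_mul, sum_toReal, one_mul]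

lemma expect_mono (p : PMF α) {f g : α → ℝ} (h : ∀ x, f x ≤ g x) : expect p f ≤ expect p g :=
  Finset.sum_le_sum fun x _ => mul_le_mul_of_nonneg_left (h x) ENNReal.toReal_nonneg

lemma expect_nonneg (p : PMF α) {f : α → ℝ} (h : ∀ x, 0 ≤ f x) : 0 ≤ expect p f :=
  Finset.sum_nonneg fun x _ => mul_nonneg ENNReal.toReal_nonneg (h x)

lemma expect_le (p : PMF α) {f : α → ℝ} {c : ℝ} (h : ∀ x, f x ≤ c) : expect p f ≤ c :=
  (expect_mono p h).trans_eq (expect_const p c)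

lemma expect_add (p : PMF α) (f g : α → ℝ) :
    expect p (fun x => f x + g x) = expect p f + expect p g := by
  simp only [expect, mul_add, Finset.sum_add_distrib]

lemma expect_sub (p : PMF α) (f g : α → ℝ) :
    expect p (fun x => f x - g x) = expect p f - expect p g := by
  simp only [expect, mul_sub, Finset.sum_sub_distrib]

lemma expect_const_mul (p : PMF α) (c : ℝ) (f : α → ℝ) :
    expect p (fun x => c * f x) = c * expect p f := by
  simp only [expect, Finset.mul_sum]
  exact Finset.sum_congr rfl fun x _ => by ring

lemma expect_mul_const (p : PMF α) (c : ℝ) (f : α → ℝ) :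
    expect p (fun x => f x * c) = expect p f * c := by
  simp only [expect, Finset.sum_mul, mul_assoc]

lemma expect_pure (a : α) (f : α → ℝ) : expect (PMF.pure a) f = f a := by
  classical
  rw [expect, Finset.sum_eq_single a] <;> simp +contextual [PMF.pure_apply]

lemma expect_bind (p : PMF α) (g : α → PMF β) (f : β → ℝ) :
    expect (p.bind g) f = expect p fun a => expect (g a) f := by
  simp only [expect, PMF.bind_apply, tsum_fintype, Finset.mul_sum]
  rw [Finset.sum_comm]
  refine Finset.sum_congr rfl fun b _ => ?_
  rw [ENNReal.toReal_sum fun a _ => ENNReal.mul_ne_top (p.apply_ne_top a) ((g a).apply_ne_top b),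
    Finset.sum_mul]
  exact Finset.sum_congr rfl fun a _ => by rw [ENNReal.toReal_mul]; ring

lemma expect_map (p : PMF α) (g : α → β) (f : β → ℝ) :
    expect (p.map g) f = expect p fun a => f (g a) := by
  rw [PMF.map, expect_bind]
  exact congrArg _ (funext fun a => expect_pure (g a) f)

/-- A batch lives in a finite type and is handled by real expectations, a run is a list and needs
the outer measure; this passes from one to the other. -/
lemma toOuterMeasure_eq_ofReal_expect (p : PMF α) (E : Set α) :
    p.toOuterMeasure E = ENNReal.ofReal (expect p (E.indicator fun _ => 1)) := by
  classical
  rw [PMF.toOuterMeasure_apply_fintype, expect, ENNReal.ofReal_sum_of_nonneg]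
  · refine Finset.sum_congr rfl fun x _ => ?_
    by_cases hx : x ∈ E
    · simp [hx, ENNReal.ofReal_toReal (p.apply_ne_top x)]
    · simp [hx]
  · exact fun x _ => mul_nonneg ENNReal.toReal_nonneg (Set.indicator_nonneg (by simp) x)

end Expectation

/-! ### Discounted occupancy as the resolvent of a stochastic matrix -/

section Occupancy

open Matrix

variable {S : Type*} [Fintype S] [DecidableEq S]

/-- Discounted occupancy `∑_t γ^t P^t` of a transition matrix. -/
def occupancy (P : Matrix S S ℝ) (γ : ℝ) (s s' : S) : ℝ := ∑' t : ℕ, γ ^ t * (P ^ t) s s'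

variable {P : Matrix S S ℝ} {γ : ℝ}

lemma occupancy_summable (hP : P ∈ rowStochastic ℝ S) (h0 : 0 ≤ γ) (h1 : γ < 1) (s s' : S) :
    Summable fun t : ℕ => γ ^ t * (P ^ t) s s' := by
  refine Summable.of_nonneg_of_le (fun t => ?_) (fun t => ?_) (summable_geometric_of_lt_one h0 h1)
  · exact mul_nonneg (pow_nonneg h0 t) (nonneg_of_mem_rowStochastic (pow_mem hP t))
  · exact mul_le_of_le_one_right (pow_nonneg h0 t) (le_one_of_mem_rowStochastic (pow_mem hP t))

lemma occupancy_nonneg (hP : P ∈ rowStochastic ℝ S) (h0 : 0 ≤ γ) (s s' : S) :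
    0 ≤ occupancy P γ s s' :=
  tsum_nonneg fun t => mul_nonneg (pow_nonneg h0 t) (nonneg_of_mem_rowStochastic (pow_mem hP t))

/-- This is the term t = 0. It later lets the weighted potential at s dominate the divergence at s.
-/
lemma one_le_occupancy_self (hP : P ∈ rowStochastic ℝ S) (h0 : 0 ≤ γ) (h1 : γ < 1) (s : S) :
    1 ≤ occupancy P γ s s := by
  have := (occupancy_summable hP h0 h1 s s).le_tsum 0 fun t _ =>
    mul_nonneg (pow_nonneg h0 t) (nonneg_of_mem_rowStochastic (pow_mem hP t))
  simpa [occupancy] using this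

lemma tsum_pow_mul_sum (hP : P ∈ rowStochastic ℝ S) (h0 : 0 ≤ γ) (h1 : γ < 1) (s : S)
    (h : S → ℝ) :
    ∑' t : ℕ, γ ^ t * ∑ s', (P ^ t) s s' * h s' = ∑ s', occupancy P γ s s' * h s' := by
  simp only [Finset.mul_sum, ← mul_assoc]
  rw [Summable.tsum_finsetSum fun s' _ => (occupancy_summable hP h0 h1 s s').mul_right _]
  exact Finset.sum_congr rfl fun s' _ => tsum_mul_right

lemma occupancy_eq_left (hP : P ∈ rowStochastic ℝ S) (h0 : 0 ≤ γ) (h1 : γ < 1) (s s' : S) :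
    occupancy P γ s s' =
      (1 : Matrix S S ℝ) s s' + γ * ∑ x, P s x * occupancy P γ x s' := by
  rw [occupancy, (occupancy_summable hP h0 h1 s s').tsum_eq_zero_add]
  simp only [pow_zero, one_mul, pow_succ' P, Matrix.mul_apply, Finset.mul_sum]
  rw [Summable.tsum_finsetSum]
  · congr 1
    refine Finset.sum_congr rfl fun x _ => ?_
    rw [occupancy, ← tsum_mul_left, ← tsum_mul_left]
    exact tsum_congr fun t => by ring
  · intro x _
    refine ((occupancy_summable hP h0 h1 x s').mul_left (γ * P s x)).congr fun t => ?_
    ring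

lemma occupancy_eq_right (hP : P ∈ rowStochastic ℝ S) (h0 : 0 ≤ γ) (h1 : γ < 1) (s s' : S) :
    occupancy P γ s s' =
      (1 : Matrix S S ℝ) s s' + γ * ∑ x, occupancy P γ s x * P x s' := by
  rw [occupancy, (occupancy_summable hP h0 h1 s s').tsum_eq_zero_add]
  simp only [pow_zero, one_mul, pow_succ P, Matrix.mul_apply, Finset.mul_sum]
  rw [Summable.tsum_finsetSum]
  · congr 1
    refine Finset.sum_congr rfl fun x _ => ?_
    rw [occupancy, ← tsum_mul_right, ← tsum_mul_left]
    exact tsum_congr fun t => by ring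
  · intro x _
    refine ((occupancy_summable hP h0 h1 s x).mul_left (γ * P x s')).congr fun t => ?_
    ring

/-- Solution of the Bellman equation. -/
lemma sum_occupancy_mul (hP : P ∈ rowStochastic ℝ S) (h0 : 0 ≤ γ) (h1 : γ < 1) (h : S → ℝ)
    (s : S) :
    ∑ s', occupancy P γ s s' * h s' =
      h s + γ * ∑ x, P s x * ∑ s', occupancy P γ x s' * h s' := by
  calc ∑ s', occupancy P γ s s' * h s'
      = ∑ s', ((1 : Matrix S S ℝ) s s' * h s' +
          γ * ∑ x, P s x * (occupancy P γ x s' * h s')) := by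
        refine Finset.sum_congr rfl fun s' _ => ?_
        rw [occupancy_eq_left hP h0 h1, add_mul, mul_assoc, Finset.sum_mul]
        simp only [mul_assoc]
    _ = _ := by
        rw [Finset.sum_add_distrib, ← Finset.mul_sum, Finset.sum_comm]
        simp [Matrix.one_apply, Finset.mul_sum]

/-- The occupancy matrix is a left inverse of 1 - γP, by `occupancy_eq_right`. This is the source of
the performance difference inequality. -/
lemma sum_occupancy_mul_sub (hP : P ∈ rowStochastic ℝ S) (h0 : 0 ≤ γ) (h1 : γ < 1)
    (y : S → ℝ) (s : S) :
    ∑ s', occupancy P γ s s' * (y s' - γ * ∑ x, P s' x * y x) = y s := by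
  have : ∑ s', occupancy P γ s s' * y s' = ∑ s', ((1 : Matrix S S ℝ) s s' * y s' +
          γ * ∑ x, occupancy P γ s x * (P x s' * y s')) := by
    refine Finset.sum_congr rfl fun s' _ => ?_
    conv_lhs => rw [occupancy_eq_right hP h0 h1, add_mul, mul_assoc, Finset.sum_mul]
    simp only [mul_assoc]
  simp only [mul_sub, Finset.sum_sub_distrib]
  rw [this, Finset.sum_add_distrib, ← Finset.mul_sum, Finset.sum_comm]
  simp only [Matrix.one_apply, ite_mul, one_mul, zero_mul, Finset.sum_ite_eq, Finset.mem_univ,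
    if_true, Finset.mul_sum]
  rw [add_sub_assoc, ← Finset.sum_sub_distrib, Finset.sum_eq_zero, add_zero]
  intro x _
  rw [sub_eq_zero]
  exact Finset.sum_congr rfl fun _ _ => by ring

lemma sum_occupancy (hP : P ∈ rowStochastic ℝ S) (h0 : 0 ≤ γ) (h1 : γ < 1) (s : S) :
    ∑ s', occupancy P γ s s' = 1 / (1 - γ) := by
  have h := sum_occupancy_mul_sub hP h0 h1 (fun _ => 1) s
  simp only [mul_one, sum_row_of_mem_rowStochastic hP, ← Finset.sum_mul] at h
  rw [eq_div_iff (by linarith), h]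

end Occupancy

/-! ### Bellman equations and performance difference -/

section Values

variable {S : Type u} {A : Type v} (M : MDP S A)

lemma one_sub_γ_pos : 0 < 1 - M.γ := sub_pos.2 M.γ_lt_one

lemma one_add_γ_mul : 1 + M.γ * (1 / (1 - M.γ)) = 1 / (1 - M.γ) := by
  have := one_sub_γ_pos M
  field_simp
  ring

variable [Fintype S] [DecidableEq S] [Fintype A]

lemma transition_mem (π : Policy S A) : transition M π ∈ Matrix.rowStochastic ℝ S := by
  rw [Matrix.mem_rowStochastic_iff_sum]
  refine ⟨fun s s' => Finset.sum_nonneg fun a _ =>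
    mul_nonneg ENNReal.toReal_nonneg ENNReal.toReal_nonneg, fun s => ?_⟩
  change ∑ s', ∑ a, (π s a).toReal * (M.P s a s').toReal = 1
  rw [Finset.sum_comm]
  simp only [← Finset.mul_sum, sum_toReal, mul_one]

/-- State-action value function. -/
def qValue (π : Policy S A) (s : S) (a : A) : ℝ :=
  M.c s a + M.γ * expect (M.P s a) (value M π)

lemma value_eq_sum (π : Policy S A) (s : S) :
    value M π s = ∑ s', occupancy (transition M π) M.γ s s' * expect (π s') (M.c s') :=
  tsum_pow_mul_sum (transition_mem M π) M.γ_pos.le M.γ_lt_one s _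

lemma value_eq_expect_qValue (π : Policy S A) (s : S) :
    value M π s = expect (π s) (qValue M π s) := by
  have h := sum_occupancy_mul (transition_mem M π) M.γ_pos.le M.γ_lt_one
    (fun s' => expect (π s') (M.c s')) s
  simp_rw [← value_eq_sum M π] at h
  have h2 : expect (π s) (qValue M π s) = expect (π s) (M.c s) +
      M.γ * expect (π s) fun a => expect (M.P s a) (value M π) := by
    rw [← expect_const_mul, ← expect_add]
    rfl
  rw [h, h2]
  congr 2
  change ∑ x, (∑ a, (π s a).toReal * (M.P s a x).toReal) * value M π x =
    ∑ a, (π s a).toReal * ∑ x, (M.P s a x).toReal * value M π x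
  simp only [Finset.sum_mul, Finset.mul_sum]
  rw [Finset.sum_comm]
  simp only [mul_assoc]

lemma value_nonneg (π : Policy S A) (s : S) : 0 ≤ value M π s := by
  rw [value_eq_sum]
  exact Finset.sum_nonneg fun s' _ => mul_nonneg
    (occupancy_nonneg (transition_mem M π) M.γ_pos.le s s') (expect_nonneg _ (M.c_nonneg s'))

lemma value_le (π : Policy S A) (s : S) : value M π s ≤ 1 / (1 - M.γ) := by
  rw [value_eq_sum, ← sum_occupancy (transition_mem M π) M.γ_pos.le M.γ_lt_one s]
  exact Finset.sum_le_sum fun s' _ => mul_le_of_le_one_right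
    (occupancy_nonneg (transition_mem M π) M.γ_pos.le s s') (expect_le _ (M.c_le_one s'))

lemma qValue_nonneg (π : Policy S A) (s : S) (a : A) : 0 ≤ qValue M π s a :=
  add_nonneg (M.c_nonneg s a) (mul_nonneg M.γ_pos.le (expect_nonneg _ (value_nonneg M π)))

lemma qValue_le (π : Policy S A) (s : S) (a : A) : qValue M π s a ≤ 1 / (1 - M.γ) := by
  rw [← one_add_γ_mul M]
  exact add_le_add (M.c_le_one s a)
    (mul_le_mul_of_nonneg_left (expect_le _ (value_le M π)) M.γ_pos.le)

/-- An optimal policy is dominated by some greedy choice of actions. -/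
lemma exists_greedy (π : Policy S A) : ∃ σ : S → A, ∀ s, qValue M π s (σ s) ≤ value M π s := by
  have (s : S) : ∃ a, qValue M π s a ≤ value M π s := by
    by_contra! h
    -- V is the π-average of Q, so if Q > V at every action, all the weights vanish, contradicting
    -- total mass one.
    have h1 : ∑ a, (π s a).toReal * (qValue M π s a - value M π s) = 0 := by
      simp only [mul_sub, Finset.sum_sub_distrib, ← Finset.sum_mul, sum_toReal, one_mul]
      rw [sub_eq_zero]
      exact (value_eq_expect_qValue M π s).symm
    rw [Finset.sum_eq_zero_iff_of_nonneg fun a _ =>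
      mul_nonneg ENNReal.toReal_nonneg (sub_nonneg.2 (h a).le)] at h1
    have h2 : ∑ a, (π s a).toReal = 0 := Finset.sum_eq_zero fun a ha =>
      (mul_eq_zero.1 (h1 a ha)).resolve_right (sub_pos.2 (h a)).ne'
    simp [sum_toReal] at h2
  choose σ hσ using this
  exact ⟨σ, hσ⟩

/-- Performance difference inequality for the occupancy measure of a greedy choice of actions. -/
lemma exists_weight (πs : Policy S A) : ∃ σ : S → A, ∀ s, ∃ w : S → ℝ, (∀ s', 0 ≤ w s') ∧
    1 ≤ w s ∧ ∑ s', w s' = 1 / (1 - M.γ) ∧ ∀ π : Policy S A,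
      value M π s - value M πs s ≤ ∑ s', w s' * (value M π s' - qValue M π s' (σ s')) := by
  obtain ⟨σ, hσ⟩ := exists_greedy M πs
  let P : Matrix S S ℝ := fun s s' => (M.P s (σ s) s').toReal
  have hP : P ∈ Matrix.rowStochastic ℝ S := Matrix.mem_rowStochastic_iff_sum.2
    ⟨fun _ _ => ENNReal.toReal_nonneg, fun s => sum_toReal _⟩
  refine ⟨σ, fun s => ⟨occupancy P M.γ s, occupancy_nonneg hP M.γ_pos.le s,
    one_le_occupancy_self hP M.γ_pos.le M.γ_lt_one s, sum_occupancy hP M.γ_pos.le M.γ_lt_one s,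
    fun π => ?_⟩⟩
  rw [← sum_occupancy_mul_sub hP M.γ_pos.le M.γ_lt_one (fun s => value M π s - value M πs s) s]
  refine Finset.sum_le_sum fun s' _ => mul_le_mul_of_nonneg_left ?_
    (occupancy_nonneg hP M.γ_pos.le s s')
  have h1 : ∑ x, P s' x * (value M π x - value M πs x) =
      expect (M.P s' (σ s')) (value M π) - expect (M.P s' (σ s')) (value M πs) :=
    expect_sub _ _ _
  have h2 := hσ s'
  rw [qValue] at h2
  rw [h1, qValue]
  linarith

end Values

/-! ### The mirror step for the Tsallis divergence of index 1/2 -/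

section Mirror

variable {A : Type v} [Fintype A]

lemma exists_pmf_toReal_eq (f : A → ℝ) (h0 : ∀ a, 0 ≤ f a) (h1 : ∑ a, f a = 1) :
    ∃ p : PMF A, ∀ a, (p a).toReal = f a := by
  refine ⟨PMF.ofFintype (fun a => ENNReal.ofReal (f a)) ?_, fun a => ?_⟩
  · rw [← ENNReal.ofReal_sum_of_nonneg fun a _ => h0 a, h1, ENNReal.ofReal_one]
  · rw [PMF.ofFintype_apply, ENNReal.toReal_ofReal (h0 a)]

lemma tsallisDiv_half_eq (x y : PMF A) :
    tsallisDiv (1 / 2) x y = -(∑ a, √(x a).toReal) + 1 / 2 * ∑ a, √(y a).toReal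
      + 1 / 2 * ∑ a, (x a).toReal / √(y a).toReal := by
  rw [tsallisDiv]
  simp only [Real.sqrt_eq_rpow, div_eq_mul_inv, ← Real.rpow_neg ENNReal.toReal_nonneg]
  norm_num

/-- Completing the square in each coordinate; nonnegativity and the equality case can then be read
off. -/
lemma tsallisDiv_half_eq_sum (x y : PMF A) (hy : ∀ a, 0 < (y a).toReal) :
    tsallisDiv (1 / 2) x y =
      ∑ a, (√(x a).toReal - √(y a).toReal) ^ 2 / (2 * √(y a).toReal) := by
  rw [tsallisDiv_half_eq, ← Finset.sum_neg_distrib, Finset.mul_sum, Finset.mul_sum,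
    ← Finset.sum_add_distrib, ← Finset.sum_add_distrib]
  refine Finset.sum_congr rfl fun a _ => ?_
  have h1 := Real.sqrt_pos.2 (hy a)
  have h2 := Real.sq_sqrt (ENNReal.toReal_nonneg (a := x a))
  field_simp
  rw [← h2]
  simp only [Real.sqrt_sq (Real.sqrt_nonneg _)]
  ring

lemma tsallisDiv_half_nonneg (x y : PMF A) (hy : ∀ a, 0 < (y a).toReal) :
    0 ≤ tsallisDiv (1 / 2) x y := by
  rw [tsallisDiv_half_eq_sum x y hy]
  exact Finset.sum_nonneg fun a _ => by positivity

lemma eq_of_tsallisDiv_half_nonpos (x y : PMF A) (hy : ∀ a, 0 < (y a).toReal)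
    (h : tsallisDiv (1 / 2) x y ≤ 0) : x = y := by
  have h0 := le_antisymm h (tsallisDiv_half_nonneg x y hy)
  rw [tsallisDiv_half_eq_sum x y hy, Finset.sum_eq_zero_iff_of_nonneg
    fun a _ => by positivity] at h0
  refine PMF.ext fun a => ?_
  have h1 := Real.sqrt_pos.2 (hy a)
  have h2 := h0 a (Finset.mem_univ a)
  rw [div_eq_zero_iff] at h2
  have h3 := h2.resolve_right (by positivity)
  rw [sq_eq_zero_iff, sub_eq_zero, Real.sqrt_inj ENNReal.toReal_nonneg ENNReal.toReal_nonneg] at h3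
  exact (ENNReal.toReal_eq_toReal_iff' (x.apply_ne_top a) (y.apply_ne_top a)).1 h3

/-- Intermediate value theorem for the Lagrange multiplier: the sum is at most 1 at μ = 0, and at
least 1 at μ = 1 - min b, where one summand equals 1. -/
lemma exists_shift_sum_inv_sq_eq_one [Nonempty A] (b : A → ℝ) (hb : ∀ a, 1 ≤ b a)
    (hsum : ∑ a, (b a)⁻¹ ^ 2 ≤ 1) : ∃ μ : ℝ, (∀ a, 1 ≤ b a + μ) ∧ ∑ a, (b a + μ)⁻¹ ^ 2 = 1 := by
  obtain ⟨a₀, ha₀⟩ := Finite.exists_min b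
  have hpos (μ : ℝ) (hμ : μ ∈ Set.Icc (1 - b a₀) 0) (a : A) : 1 ≤ b a + μ := by
    linarith [hμ.1, ha₀ a]
  have hcont : ContinuousOn (fun μ : ℝ => ∑ a, (b a + μ)⁻¹ ^ 2) (Set.Icc (1 - b a₀) 0) := by
    refine continuousOn_finsetSum _ fun a _ => ContinuousOn.pow (ContinuousOn.inv₀ ?_ ?_) 2
    · fun_prop
    · intro μ hμ
      linarith [hpos μ hμ a]
  have h1 : (1 : ℝ) ∈ Set.Icc (∑ a, (b a + 0)⁻¹ ^ 2) (∑ a, (b a + (1 - b a₀))⁻¹ ^ 2) := by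
    refine ⟨by simpa using hsum, ?_⟩
    refine le_trans ?_ (Finset.single_le_sum
      (f := fun a => (b a + (1 - b a₀))⁻¹ ^ 2) (fun a _ => sq_nonneg _) (Finset.mem_univ a₀))
    simp
  obtain ⟨μ, hμ, h2⟩ := intermediate_value_Icc' (by linarith [hb a₀]) hcont h1
  exact ⟨μ, hpos μ hμ, h2⟩

/-- Explicit form of the minimizer of the mirror descent step. -/
lemma exists_mirror_point (η : ℝ) (Q : A → ℝ) (y : PMF A) (hη : 0 ≤ η) (hQ : ∀ a, 0 ≤ Q a)
    (hy : ∀ a, 0 < (y a).toReal) : ∃ (x : PMF A) (μ : ℝ), (∀ a, 0 < (x a).toReal) ∧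
      ∀ a, (√(x a).toReal)⁻¹ = (√(y a).toReal)⁻¹ + 2 * η * Q a + μ := by
  have : Nonempty A := y.support_nonempty.to_type
  have hb0 (a : A) : 0 ≤ 2 * η * Q a := by have := hQ a; positivity
  have hs (a : A) : 0 < √(y a).toReal := Real.sqrt_pos.2 (hy a)
  have hb (a : A) : 1 ≤ (√(y a).toReal)⁻¹ + 2 * η * Q a := by
    have : 1 ≤ (√(y a).toReal)⁻¹ :=
      (one_le_inv₀ (hs a)).2 (Real.sqrt_le_one.2 (toReal_le_one y a))
    linarith [hb0 a]
  obtain ⟨μ, h1, h2⟩ := exists_shift_sum_inv_sq_eq_one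
    (fun a => (√(y a).toReal)⁻¹ + 2 * η * Q a) hb (by
      rw [← sum_toReal y]
      refine Finset.sum_le_sum fun a _ => ?_
      have h3 : ((√(y a).toReal)⁻¹ + 2 * η * Q a)⁻¹ ≤ √(y a).toReal := by
        rw [inv_le_comm₀ (by linarith [hb a]) (hs a)]
        linarith [hb0 a]
      calc _ ≤ √(y a).toReal ^ 2 :=
            pow_le_pow_left₀ (inv_nonneg.2 (by linarith [hb a])) h3 2
        _ = _ := Real.sq_sqrt ENNReal.toReal_nonneg)
  obtain ⟨x, hx⟩ := exists_pmf_toReal_eq _ (fun a => sq_nonneg _) h2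
  have hp (a : A) : 0 < ((√(y a).toReal)⁻¹ + 2 * η * Q a + μ)⁻¹ := inv_pos.2 (by linarith [h1 a])
  refine ⟨x, μ, fun a => ?_, fun a => ?_⟩
  · rw [hx]
    exact pow_pos (hp a) 2
  · rw [hx, Real.sqrt_sq (hp a).le, inv_inv]

/-- Three-point identity, with equality: by the stationarity condition `h` the linear terms reduce
to μ/2 times the sum of x - z, which is zero on the simplex, and the remainder is the divergence
from z. -/
lemma stepObjective_eq_add (η : ℝ) (Q : A → ℝ) (y z x : PMF A) (μ : ℝ)
    (hy : ∀ a, 0 < (y a).toReal) (hz : ∀ a, 0 < (z a).toReal)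
    (h : ∀ a, (√(z a).toReal)⁻¹ = (√(y a).toReal)⁻¹ + 2 * η * Q a + μ) :
    stepObjective η Q y x = stepObjective η Q y z + tsallisDiv (1 / 2) x z := by
  have h1 : ∑ a, ((x a).toReal - (z a).toReal) * (μ / 2) = 0 := by
    rw [← Finset.sum_mul, Finset.sum_sub_distrib, sum_toReal, sum_toReal, sub_self, zero_mul]
  rw [← add_zero (stepObjective η Q y x), ← h1]
  simp only [stepObjective, tsallisDiv_half_eq_sum _ _ hy, tsallisDiv_half_eq_sum _ _ hz,
    Finset.mul_sum, ← Finset.sum_add_distrib]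
  rw [← sub_eq_zero, ← Finset.sum_sub_distrib]
  refine Finset.sum_eq_zero fun a _ => ?_
  have hs := Real.sqrt_pos.2 (hy a)
  have ht := Real.sqrt_pos.2 (hz a)
  have e1 := Real.sq_sqrt (ENNReal.toReal_nonneg (a := x a))
  have e2 := Real.sq_sqrt (hz a).le
  have e3 : μ = (√(z a).toReal)⁻¹ - (√(y a).toReal)⁻¹ - 2 * η * Q a := by linarith [h a]
  rw [e3, ← e1, ← e2]
  simp only [Real.sqrt_sq (Real.sqrt_nonneg _)]
  field_simp
  ring

/-- By the three-point identity the explicit point z is the unique minimizer, so the chosen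
minimizer is z. -/
lemma mirrorStep_spec (η : ℝ) (Q : A → ℝ) (y : PMF A) (hη : 0 ≤ η) (hQ : ∀ a, 0 ≤ Q a)
    (hy : ∀ a, 0 < (y a).toReal) :
    (∀ a, 0 < (mirrorStep η Q y a).toReal) ∧ ∀ x, stepObjective η Q y x =
      stepObjective η Q y (mirrorStep η Q y) + tsallisDiv (1 / 2) x (mirrorStep η Q y) := by
  obtain ⟨z, μ, hz, h⟩ := exists_mirror_point η Q y hη hQ hy
  have hJ (x : PMF A) := stepObjective_eq_add η Q y z x μ hy hz h
  have hex : ∃ x : PMF A, ∀ x' : PMF A, stepObjective η Q y x ≤ stepObjective η Q y x' :=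
    ⟨z, fun x' => by linarith [hJ x', tsallisDiv_half_nonneg x' z hz]⟩
  have heq : mirrorStep η Q y = z := by
    rw [mirrorStep, dif_pos hex]
    refine eq_of_tsallisDiv_half_nonpos _ z hz ?_
    linarith [hex.choose_spec z, hJ hex.choose]
  rw [heq]
  exact ⟨hz, hJ⟩

/-- One-step regret inequality of mirror descent with nonnegative bounded losses. -/
lemma mirrorStep_regret (η B : ℝ) (Q : A → ℝ) (y : PMF A) (hη : 0 ≤ η) (hQ : ∀ a, 0 ≤ Q a)
    (hB : ∀ a, Q a ≤ B) (hy : ∀ a, 0 < (y a).toReal) (x : PMF A) :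
    η * (expect y Q - expect x Q) ≤ tsallisDiv (1 / 2) x y
      - tsallisDiv (1 / 2) x (mirrorStep η Q y) + 2 * η ^ 2 * B ^ 2 := by
  have h := (mirrorStep_spec η Q y hη hQ hy).2 x
  set z := mirrorStep η Q y
  have hcomm (p : PMF A) : expect p Q = ∑ a, Q a * (p a).toReal :=
    Finset.sum_congr rfl fun a _ => mul_comm _ _
  have hloc : η * (expect y Q - expect z Q) - tsallisDiv (1 / 2) z y ≤ 2 * η ^ 2 * B ^ 2 := by
    rw [tsallisDiv_half_eq_sum z y hy, expect, expect, ← Finset.sum_sub_distrib, Finset.mul_sum,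
      ← Finset.sum_sub_distrib, ← mul_one (2 * η ^ 2 * B ^ 2), ← sum_toReal y, Finset.mul_sum]
    refine Finset.sum_le_sum fun a _ => ?_
    have hs := Real.sqrt_pos.2 (hy a)
    have hs1 : √(y a).toReal ≤ 1 := Real.sqrt_le_one.2 (toReal_le_one y a)
    have e1 := Real.sq_sqrt (hy a).le
    have e2 := Real.sq_sqrt (ENNReal.toReal_nonneg (a := z a))
    have hq := hQ a
    rw [← e1, ← e2]
    simp only [Real.sqrt_sq (Real.sqrt_nonneg _)]
    generalize √(y a).toReal = v at *
    generalize √(z a).toReal = w at *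
    have k1 : (w - v) ^ 2 / (2 * v) = (w - v) ^ 2 * (2 * v)⁻¹ := div_eq_mul_inv _ _
    -- The slack is a perfect square over 2v plus ηQ(v - w)². Since the losses are nonnegative, no
    -- upper bound on η is needed.
    calc η * (v ^ 2 * Q a - w ^ 2 * Q a) - (w - v) ^ 2 / (2 * v)
        ≤ 2 * η ^ 2 * Q a ^ 2 * v ^ 3 := by
          rw [sub_le_iff_le_add, ← sub_nonneg]
          have : 2 * η ^ 2 * Q a ^ 2 * v ^ 3 + (w - v) ^ 2 / (2 * v)
              - η * (v ^ 2 * Q a - w ^ 2 * Q a)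
              = (2 * η * Q a * v ^ 2 - (v - w)) ^ 2 / (2 * v) + η * Q a * (v - w) ^ 2 := by
            field_simp
            ring
          rw [this]
          positivity
      _ ≤ 2 * η ^ 2 * B ^ 2 * v ^ 2 := by
          have h3 : v ^ 3 ≤ v ^ 2 := pow_le_pow_of_le_one hs.le hs1 (by norm_num)
          have h4 : Q a ^ 2 ≤ B ^ 2 := pow_le_pow_left₀ hq (hB a) 2
          gcongr
  simp only [stepObjective, ← hcomm] at h
  linarith

lemma tsallisDiv_half_pure [DecidableEq A] (a : A) (y : PMF A) :
    tsallisDiv (1 / 2) (PMF.pure a) y =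
      -1 + 1 / 2 * ∑ b, √(y b).toReal + 1 / 2 * (√(y a).toReal)⁻¹ := by
  rw [tsallisDiv_half_eq]
  simp [apply_ite, ite_div]

/-- Barrier property: the divergence from a point mass blows up as the probability of that action
tends to 0, so bounding it keeps the action away from the truncation threshold. -/
lemma inv_sqrt_le_tsallisDiv_half_pure (a : A) (y : PMF A) :
    (√(y a).toReal)⁻¹ ≤ 2 * (1 + tsallisDiv (1 / 2) (PMF.pure a) y) := by
  classical
  rw [tsallisDiv_half_pure]
  have : 0 ≤ ∑ b, √(y b).toReal := Finset.sum_nonneg fun b _ => Real.sqrt_nonneg _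
  linarith

lemma uniformOfFintype_toReal [Nonempty A] (a : A) :
    (PMF.uniformOfFintype A a).toReal = (Fintype.card A : ℝ)⁻¹ := by
  simp [PMF.uniformOfFintype_apply]

lemma tsallisDiv_half_pure_uniform [Nonempty A] (a : A) :
    tsallisDiv (1 / 2) (PMF.pure a) (PMF.uniformOfFintype A) = √(Fintype.card A) - 1 := by
  classical
  rw [tsallisDiv_half_pure]
  simp only [uniformOfFintype_toReal, Real.sqrt_inv, inv_inv, Finset.sum_const, Finset.card_univ,
    nsmul_eq_mul]
  rw [← div_eq_mul_inv, Real.div_sqrt]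
  ring

end Mirror

/-! ### Regret of policy mirror descent with truncated estimates -/

section Regret

variable {S : Type u} {A : Type v} [Fintype S] [DecidableEq S] [Fintype A]

/-- If the comparator action is not truncated and the estimate is accurate on all actions that are
not truncated, then the estimation error costs at most `2 η e` in the regret at one state. -/
lemma one_step_gap (M : MDP S A) (π : Policy S A) (s : S) (Qh : A → ℝ) (η e τ : ℝ) (a : A)
    (hη : 0 ≤ η) (he : 0 ≤ e) (hpos : ∀ a, 0 < (π s a).toReal)
    (hQ0 : ∀ a, 0 ≤ Qh a) (hQ1 : ∀ a, Qh a ≤ 1 / (1 - M.γ))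
    (hacc : ∀ a, τ ≤ (π s a).toReal → |Qh a - qValue M π s a| ≤ e)
    (htrunc : ∀ a, (π s a).toReal < τ → Qh a = 1 / (1 - M.γ))
    (ha : τ ≤ (π s a).toReal) :
    η * (value M π s - qValue M π s a) ≤ tsallisDiv (1 / 2) (PMF.pure a) (π s)
      - tsallisDiv (1 / 2) (PMF.pure a) (mirrorStep η Qh (π s))
      + (2 * η ^ 2 * (1 / (1 - M.γ)) ^ 2 + 2 * η * e) := by
  have h1 := mirrorStep_regret η (1 / (1 - M.γ)) Qh (π s) hη hQ0 hQ1 hpos (PMF.pure a)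
  rw [expect_pure] at h1
  have h2 : value M π s - expect (π s) Qh ≤ e := by
    rw [value_eq_expect_qValue, ← expect_sub]
    refine expect_le _ fun b => ?_
    rcases lt_or_ge (π s b).toReal τ with hb | hb
    -- Truncation overestimates Q, so in this direction it costs nothing.
    · rw [htrunc b hb]
      linarith [qValue_le M π s b]
    · linarith [(abs_le.1 (hacc b hb)).1]
  have h3 := (abs_le.1 (hacc a ha)).2
  have h4 : η * (value M π s - qValue M π s a) ≤ η * (expect (π s) Qh - Qh a + 2 * e) :=
    mul_le_mul_of_nonneg_left (by linarith) hη
  linarith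

lemma threshold_le_of_inv_sqrt_le {γ x : ℝ} {cardA : ℕ} (hγ : 0 < 1 - γ)
    (hA : 0 < cardA) (hx : 0 < x) (h : (√x)⁻¹ ≤ 4 / (1 - γ) * √cardA) :
    threshold γ cardA ≤ x := by
  have hs := Real.sqrt_pos.2 hx
  have hA' : (0 : ℝ) < cardA := by exact_mod_cast hA
  have h1 : (√x)⁻¹ ^ 2 ≤ (4 / (1 - γ) * √cardA) ^ 2 := pow_le_pow_left₀ (by positivity) h 2
  rw [inv_pow, Real.sq_sqrt hx.le, mul_pow, Real.sq_sqrt hA'.le] at h1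
  rw [threshold, ← mul_inv, inv_le_comm₀ (by positivity) hx]
  exact h1

/-- Regret bound of policy mirror descent with truncated accurate estimates. -/
theorem sum_gap_le [Nonempty A] (M : MDP S A) (πs : Policy S A) (hopt : IsOptimal M πs) (π : ℕ → Policy S A)
    (Qh : ℕ → S → A → ℝ) (η e : ℝ) (k : ℕ) (hη : 0 ≤ η) (he : 0 ≤ e)
    (h0 : π 0 = fun _ => PMF.uniformOfFintype A)
    (hstep : ∀ t < k, ∀ s, π (t + 1) s = mirrorStep η (Qh t s) (π t s))
    (hQ0 : ∀ t < k, ∀ s a, 0 ≤ Qh t s a) (hQ1 : ∀ t < k, ∀ s a, Qh t s a ≤ 1 / (1 - M.γ))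
    (hacc : ∀ t < k, ∀ s a, threshold M.γ (Fintype.card A) ≤ (π t s a).toReal →
      |Qh t s a - qValue M (π t) s a| ≤ e)
    (htrunc : ∀ t < k, ∀ s a, (π t s a).toReal < threshold M.γ (Fintype.card A) →
      Qh t s a = 1 / (1 - M.γ))
    (hbudget : k * (2 * η ^ 2 * (1 / (1 - M.γ)) ^ 2 + 2 * η * e) ≤
      (√(Fintype.card A) - 1) / 2) (s : S) :
    ∑ t ∈ Finset.range k, η * (value M (π t) s - value M πs s) ≤
      1 / (1 - M.γ) * (3 / 2 * (√(Fintype.card A) - 1)) := by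
  obtain ⟨σ, hσ⟩ := exists_weight M πs
  choose w hw0 hw1 hwsum hw using hσ
  have hγ := one_sub_γ_pos M
  have hM1 : 1 ≤ 1 / (1 - M.γ) := by
    rw [le_div_iff₀ hγ]; linarith [M.γ_pos]
  set B := 1 / (1 - M.γ) with hB
  set R := √(Fintype.card A : ℝ) with hR
  have hR1 : 1 ≤ R := Real.one_le_sqrt.2 (by exact_mod_cast Fintype.card_pos)
  set κ := 2 * η ^ 2 * B ^ 2 + 2 * η * e with hκ
  have hκ0 : 0 ≤ κ := by positivity
  have hpos (t : ℕ) (ht : t ≤ k) (s : S) (a : A) : 0 < (π t s a).toReal := by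
    induction t generalizing a with
    | zero => rw [h0, uniformOfFintype_toReal]; exact inv_pos.2 (by exact_mod_cast Fintype.card_pos)
    | succ t ih =>
      rw [hstep t ht s]
      exact (mirrorStep_spec η _ _ hη (hQ0 t ht s) fun a => ih (by omega) a).1 a
  -- One potential per starting state; the induction carries all of them together, since a step at s
  -- needs that σ is untruncated at every state.
  let Φ (t : ℕ) (s : S) : ℝ := ∑ s', w s s' * tsallisDiv (1 / 2) (PMF.pure (σ s')) (π t s')
  have key (t : ℕ) (ht : t ≤ k) : ∀ s, Φ t s +
      ∑ i ∈ Finset.range t, η * (value M (π i) s - value M πs s) ≤ B * (R - 1 + t * κ) := by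
    induction t with
    | zero =>
      intro s
      simp only [Φ, h0, tsallisDiv_half_pure_uniform, Finset.range_zero, Finset.sum_empty,
        ← Finset.sum_mul, hwsum]
      simp [R]
    | succ t ih =>
      have ih := ih (by omega)
      have htk : (t : ℝ) * κ ≤ (R - 1) / 2 := le_trans
        (mul_le_mul_of_nonneg_right (by exact_mod_cast (by omega : t ≤ k)) hκ0) hbudget
      have hσ (s : S) : threshold M.γ (Fintype.card A) ≤ (π t s (σ s)).toReal := by
        have hD (s' : S) := tsallisDiv_half_nonneg (PMF.pure (σ s')) (π t s')
          (hpos t (by omega) s')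
        refine threshold_le_of_inv_sqrt_le hγ Fintype.card_pos (hpos t (by omega) s _) ?_
        refine (inv_sqrt_le_tsallisDiv_half_pure _ _).trans ?_
        have h1 : tsallisDiv (1 / 2) (PMF.pure (σ s)) (π t s) ≤ Φ t s :=
          le_trans (le_mul_of_one_le_left (hD s) (hw1 s)) (Finset.single_le_sum
            (f := fun s' => w s s' * tsallisDiv (1 / 2) (PMF.pure (σ s')) (π t s'))
            (fun s' _ => mul_nonneg (hw0 s s') (hD s')) (Finset.mem_univ s))
        -- Optimality of the comparator: dropping the past gaps leaves a bound on the potential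
        -- alone.
        have h2 : 0 ≤ ∑ i ∈ Finset.range t, η * (value M (π i) s - value M πs s) :=
          Finset.sum_nonneg fun i _ => mul_nonneg hη (sub_nonneg.2 (hopt _ _))
        have h3 : B * (R - 1 + t * κ) ≤ B * (R - 1 + (R - 1) / 2) := by gcongr
        have h4 : 4 / (1 - M.γ) = 4 * B := by rw [hB]; ring
        rw [h4]
        -- The threshold is made for 2(1 + (3/2)B(R - 1)) ≤ 4BR, which holds as B, R ≥ 1.
        nlinarith [ih s, mul_nonneg (sub_nonneg.2 hM1) (sub_nonneg.2 hR1)]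
      intro s
      have h1 : η * (value M (π t) s - value M πs s) ≤ Φ t s - Φ (t + 1) s + B * κ := by
        refine (mul_le_mul_of_nonneg_left (hw s (π t)) hη).trans ?_
        simp only [Φ]
        rw [← hwsum s, Finset.sum_mul, ← Finset.sum_sub_distrib, Finset.mul_sum,
          ← Finset.sum_add_distrib]
        refine Finset.sum_le_sum fun s' _ => ?_
        have h2 := mul_le_mul_of_nonneg_left (one_step_gap M (π t) s' (Qh t s') η e _ (σ s') hη he
          (hpos t (by omega) s') (hQ0 t (by omega) s') (hQ1 t (by omega) s')
          (hacc t (by omega) s') (htrunc t (by omega) s') (hσ s')) (hw0 s s')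
        rw [← hstep t (by omega) s'] at h2
        calc _ = w s s' * (η * (value M (π t) s' - qValue M (π t) s' (σ s'))) := by ring
          _ ≤ _ := h2
          _ = _ := by rw [hκ, hB]; ring
      rw [Finset.sum_range_succ]
      push_cast
      linarith [ih s]
  have h1 : 0 ≤ Φ k s := Finset.sum_nonneg fun s' _ => mul_nonneg (hw0 s s')
    (tsallisDiv_half_nonneg _ _ (hpos k le_rfl s'))
  have h2 : B * (R - 1 + k * κ) ≤ B * (3 / 2 * (R - 1)) :=
    mul_le_mul_of_nonneg_left (by linarith) (by positivity)
  linarith [key k le_rfl s]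

lemma objective_nonneg (M : MDP S A) (ϑ : PMF S) (π : Policy S A) : 0 ≤ objective M ϑ π :=
  expect_nonneg ϑ (value_nonneg M π)

lemma objective_le (M : MDP S A) (ϑ : PMF S) (π : Policy S A) :
    objective M ϑ π ≤ 1 / (1 - M.γ) :=
  expect_le ϑ (value_le M π)

lemma iInf_objective_le (M : MDP S A) (ϑ : PMF S) {k : ℕ} (π : Fin k → Policy S A) (t : Fin k) :
    ⨅ t, objective M ϑ (π t) ≤ objective M ϑ (π t) :=
  ciInf_le ⟨0, by rintro _ ⟨t, rfl⟩; exact objective_nonneg M ϑ (π t)⟩ t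

/-- The best iterate is at least as good as the average one. -/
lemma iInf_objective_sub_le (M : MDP S A) (πs : Policy S A) (π : ℕ → Policy S A) (η R : ℝ)
    {k : ℕ} (hk : 0 < k) (hη : 0 < η)
    (h : ∀ s, ∑ t ∈ Finset.range k, η * (value M (π t) s - value M πs s) ≤ R) (ϑ : PMF S) :
    (⨅ t : Fin k, objective M ϑ (π t)) - objective M ϑ πs ≤ R / (k * η) := by
  set f := ⨅ t : Fin k, objective M ϑ (π t) with hf
  have hk' : (0 : ℝ) < k := by exact_mod_cast hk
  rw [le_div_iff₀ (by positivity)]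
  calc (f - objective M ϑ πs) * (k * η)
      = ∑ _t ∈ Finset.range k, η * (f - objective M ϑ πs) := by
        rw [Finset.sum_const, Finset.card_range, nsmul_eq_mul]; ring
    _ ≤ ∑ t ∈ Finset.range k, η * (objective M ϑ (π t) - objective M ϑ πs) := by
        refine Finset.sum_le_sum fun t ht => mul_le_mul_of_nonneg_left (sub_le_sub_right ?_ _) hη.le
        exact iInf_objective_le M ϑ (fun t : Fin k => π t) ⟨t, Finset.mem_range.1 ht⟩
    _ = expect ϑ fun s => ∑ t ∈ Finset.range k, η * (value M (π t) s - value M πs s) := by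
        simp only [objective, expect, Finset.mul_sum, ← Finset.sum_sub_distrib]
        rw [Finset.sum_comm]
        exact Finset.sum_congr rfl fun _ _ => Finset.sum_congr rfl fun _ _ => by ring
    _ ≤ R := expect_le ϑ h

end Regret

/-! ### Pathwise recursions and bounds for the first-visit estimate -/

section Trajectory

variable {S : Type u} {A : Type v} (M : MDP S A)

/-- Discounted return of a trajectory. -/
def discReturn {n : ℕ} (x : Fin n → S × A) : ℝ :=
  ∑ t : Fin n, M.γ ^ (t : ℕ) * M.c (x t).1 (x t).2

lemma discReturn_cons {n : ℕ} (z : S × A) (x : Fin n → S × A) :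
    discReturn M (Fin.cons z x : Fin (n + 1) → S × A) = M.c z.1 z.2 + M.γ * discReturn M x := by
  simp only [discReturn, Fin.sum_univ_succ, Fin.cons_zero, Fin.cons_succ, Fin.val_zero, pow_zero,
    one_mul, Fin.val_succ, pow_succ', Finset.mul_sum, mul_assoc]

lemma hitTime_cons_self {n : ℕ} (z : S × A) (x : Fin n → S × A) :
    hitTime (Fin.cons z x : Fin (n + 1) → S × A) z = 0 :=
  Nat.sInf_eq_zero.2 (Or.inl (Or.inl ⟨n.succ_pos, rfl⟩))

lemma hitTime_cons_of_ne {n : ℕ} {z₀ z : S × A} (h : z₀ ≠ z) (x : Fin n → S × A) :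
    hitTime (Fin.cons z₀ x : Fin (n + 1) → S × A) z = hitTime x z + 1 := by
  apply le_antisymm
  · apply Nat.sInf_le
    have h1 : hitTime x z ∈ {t | ∃ h : t < n, x ⟨t, h⟩ = z} ∪ {n} :=
      Nat.sInf_mem ⟨n, Or.inr rfl⟩
    rcases h1 with ⟨h1, h2⟩ | h1
    · exact Or.inl ⟨Nat.succ_lt_succ h1, h2⟩
    · exact Or.inr (congrArg (· + 1) h1)
  · refine le_csInf ⟨n + 1, Or.inr rfl⟩ ?_
    rintro t (⟨h1, h2⟩ | h1)
    · cases t with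
      | zero => exact absurd h2 h
      | succ t => exact Nat.succ_le_succ (Nat.sInf_le (Or.inl ⟨Nat.lt_of_succ_lt_succ h1, h2⟩))
    · rw [h1]
      exact Nat.succ_le_succ (Nat.sInf_le (Or.inr rfl))

lemma omcSingle_cons_self {n : ℕ} (z : S × A) (x : Fin n → S × A) :
    omcSingle M (Fin.cons z x : Fin (n + 1) → S × A) z =
      discReturn M (Fin.cons z x : Fin (n + 1) → S × A) := by
  simp [omcSingle, discReturn, hitTime_cons_self]

/-- The first visit time and all indices shift by one together. With the previous lemma this allows
induction on the trajectory length, stopping at the first visit. -/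
lemma omcSingle_cons_of_ne {n : ℕ} {z₀ z : S × A} (h : z₀ ≠ z) (x : Fin n → S × A) :
    omcSingle M (Fin.cons z₀ x : Fin (n + 1) → S × A) z = omcSingle M x z := by
  simp [omcSingle, Fin.sum_univ_succ, hitTime_cons_of_ne h]

lemma discReturn_nonneg {n : ℕ} (x : Fin n → S × A) : 0 ≤ discReturn M x :=
  Finset.sum_nonneg fun _ _ => mul_nonneg (pow_nonneg M.γ_pos.le _) (M.c_nonneg _ _)

lemma discReturn_le {n : ℕ} (x : Fin n → S × A) : discReturn M x ≤ 1 / (1 - M.γ) := by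
  induction n with
  | zero => simpa [discReturn] using M.γ_lt_one.le
  | succ n ih =>
    rw [← Fin.cons_self_tail x, discReturn_cons, ← one_add_γ_mul M]
    exact add_le_add (M.c_le_one _ _) (mul_le_mul_of_nonneg_left (ih _) M.γ_pos.le)

lemma omcSingle_nonneg {n : ℕ} (x : Fin n → S × A) (z : S × A) : 0 ≤ omcSingle M x z := by
  refine Finset.sum_nonneg fun _ _ => ?_
  split_ifs
  · exact mul_nonneg (pow_nonneg M.γ_pos.le _) (M.c_nonneg _ _)
  · exact le_rfl

lemma omcSingle_le {n : ℕ} (x : Fin n → S × A) (z : S × A) :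
    omcSingle M x z ≤ 1 / (1 - M.γ) := by
  induction n with
  | zero => simpa [omcSingle] using M.γ_lt_one.le
  | succ n ih =>
    rw [← Fin.cons_self_tail x]
    by_cases h : x 0 = z
    · rw [h, omcSingle_cons_self]
      exact discReturn_le M _
    · rw [omcSingle_cons_of_ne M h]
      exact ih _

lemma omc_nonneg {m n : ℕ} (b : Batch S A m n) (s : S) (a : A) : 0 ≤ omc M b s a :=
  mul_nonneg (by positivity) (Finset.sum_nonneg fun l _ => omcSingle_nonneg M (b l) (s, a))

lemma omc_le {m n : ℕ} (b : Batch S A m n) (s : S) (a : A) : omc M b s a ≤ 1 / (1 - M.γ) := by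
  rcases m.eq_zero_or_pos with rfl | hm
  · simpa [omc] using M.γ_lt_one.le
  · have hm' : (0 : ℝ) < m := by exact_mod_cast hm
    rw [omc, one_div, inv_mul_le_iff₀ hm']
    calc _ ≤ ∑ _l : Fin m, 1 / (1 - M.γ) :=
          Finset.sum_le_sum fun l _ => omcSingle_le M (b l) (s, a)
      _ = _ := by simp

lemma tomc_nonneg (τ : ℝ) (π : Policy S A) {m n : ℕ} (b : Batch S A m n) (s : S) (a : A) :
    0 ≤ tomc M τ π b s a := by
  rw [tomc]
  split_ifs
  · exact omc_nonneg M b s a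
  · exact (one_div_pos.2 (one_sub_γ_pos M)).le

lemma tomc_le (τ : ℝ) (π : Policy S A) {m n : ℕ} (b : Batch S A m n) (s : S) (a : A) :
    tomc M τ π b s a ≤ 1 / (1 - M.γ) := by
  rw [tomc]
  split_ifs
  · exact omc_le M b s a
  · exact le_rfl

end Trajectory

/-! ### Bias of the estimate under mixing -/

section Bias

variable {S : Type u} {A : Type v} [Fintype S] [Fintype A] (M : MDP S A)
  (π : Policy S A)

/-- One-step averaging operator of the state-action chain. -/
def stepAvg (h : S × A → ℝ) (z : S × A) : ℝ :=
  expect (M.P z.1 z.2) fun s => expect (π s) fun a => h (s, a)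

lemma expect_trajLaw_succ {n : ℕ} (z : S × A) (F : (Fin (n + 1) → S × A) → ℝ) :
    expect (trajLaw M π (n + 1) z) F =
      stepAvg M π (fun z' => expect (trajLaw M π n z') fun x => F (Fin.cons z x)) z := by
  simp only [trajLaw, step, expect_bind, expect_map, stepAvg]

lemma stepAvg_mono {f g : S × A → ℝ} (h : ∀ z, f z ≤ g z) (z : S × A) :
    stepAvg M π f z ≤ stepAvg M π g z :=
  expect_mono _ fun _ => expect_mono _ fun _ => h _

lemma stepAvg_const (c : ℝ) (z : S × A) : stepAvg M π (fun _ => c) z = c := by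
  simp only [stepAvg, expect_const]

lemma stepAvg_add_mul (c d : ℝ) (f : S × A → ℝ) (z : S × A) :
    stepAvg M π (fun z => c + d * f z) z = c + d * stepAvg M π f z := by
  simp only [stepAvg, expect_add, expect_const, expect_const_mul]

lemma stepAvg_iterate_mono {f g : S × A → ℝ} (h : ∀ z, f z ≤ g z) (j : ℕ) (z : S × A) :
    (stepAvg M π)^[j] f z ≤ (stepAvg M π)^[j] g z := by
  induction j generalizing z with
  | zero => exact h z
  | succ j ih =>
    simp only [Function.iterate_succ_apply']
    exact stepAvg_mono M π ih z

lemma stepAvg_iterate_add_mul (c d : ℝ) (f : S × A → ℝ) (j : ℕ) (z : S × A) :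
    (stepAvg M π)^[j] (fun z => c + d * f z) z = c + d * (stepAvg M π)^[j] f z := by
  induction j generalizing z with
  | zero => rfl
  | succ j ih =>
    simp only [Function.iterate_succ_apply', ← stepAvg_add_mul]
    exact congrArg (fun h => stepAvg M π h z) (funext ih)

variable [DecidableEq S]

lemma qValue_eq_stepAvg (z : S × A) :
    qValue M π z.1 z.2 = M.c z.1 z.2 + M.γ * stepAvg M π (fun z => qValue M π z.1 z.2) z := by
  rw [qValue, stepAvg]
  congr 3
  exact funext fun s => value_eq_expect_qValue M π s

lemma expect_discReturn_le (n : ℕ) (z : S × A) :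
    expect (trajLaw M π n z) (discReturn M) ≤ qValue M π z.1 z.2 := by
  induction n generalizing z with
  | zero =>
    refine (expect_le _ fun x => ?_).trans (qValue_nonneg M π z.1 z.2)
    simp [discReturn]
  | succ n ih =>
    rw [expect_trajLaw_succ, qValue_eq_stepAvg, ← stepAvg_add_mul]
    refine stepAvg_mono M π (fun z' => ?_) z
    simp only [discReturn_cons, expect_add, expect_const, expect_const_mul]
    exact add_le_add le_rfl (mul_le_mul_of_nonneg_left (ih z') M.γ_pos.le)

/-- The costs cut off after time n are worth at most γ^n/(1-γ). -/
lemma qValue_le_expect_discReturn (n : ℕ) (z : S × A) :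
    qValue M π z.1 z.2 ≤
      expect (trajLaw M π n z) (discReturn M) + 1 / (1 - M.γ) * M.γ ^ n := by
  induction n generalizing z with
  | zero =>
    have := expect_nonneg (trajLaw M π 0 z) (discReturn_nonneg M)
    linarith [qValue_le M π z.1 z.2]
  | succ n ih =>
    rw [expect_trajLaw_succ, qValue_eq_stepAvg, ← stepAvg_add_mul, add_comm,
      ← one_mul (stepAvg M π (fun z' => expect _ _) z), ← stepAvg_add_mul]
    refine stepAvg_mono M π (fun z' => ?_) z
    simp only [discReturn_cons, expect_add, expect_const, expect_const_mul, pow_succ]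
    have := mul_le_mul_of_nonneg_left (ih z') M.γ_pos.le
    linarith

open Classical in
/-- Upper bound on the bias of the first-visit estimate at `z`, in units of `1 / (1 - γ)`, for a
trajectory of length `n` from a given initial pair. -/
def missWeight (z : S × A) : ℕ → S × A → ℝ
  | 0, _ => 1
  | n + 1, z₀ => if z₀ = z then M.γ ^ (n + 1) else stepAvg M π (missWeight z n) z₀

lemma missWeight_self (z : S × A) (n : ℕ) : missWeight M π z n z = M.γ ^ n := by
  cases n <;> simp [missWeight]

lemma missWeight_le_one (z : S × A) (n : ℕ) (z₀ : S × A) : missWeight M π z n z₀ ≤ 1 := by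
  induction n generalizing z₀ with
  | zero => exact le_rfl
  | succ n ih =>
    rw [missWeight]
    split_ifs
    · exact pow_le_one₀ M.γ_pos.le M.γ_lt_one.le
    · exact (stepAvg_mono M π ih z₀).trans_eq (stepAvg_const M π 1 z₀)

lemma expect_omcSingle_le (z : S × A) (n : ℕ) (z₀ : S × A) :
    expect (trajLaw M π n z₀) (fun x => omcSingle M x z) ≤ qValue M π z.1 z.2 := by
  induction n generalizing z₀ with
  | zero =>
    refine (expect_le _ fun x => ?_).trans (qValue_nonneg M π z.1 z.2)
    simp [omcSingle]
  | succ n ih =>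
    by_cases h : z₀ = z
    · subst h
      refine le_trans (le_of_eq ?_) (expect_discReturn_le M π (n + 1) z₀)
      simp only [expect_trajLaw_succ, omcSingle_cons_self]
    · simp only [expect_trajLaw_succ, omcSingle_cons_of_ne M h]
      exact (stepAvg_mono M π ih z₀).trans_eq (stepAvg_const M π _ z₀)

/-- Condition on the first visit: before it both sides are averaged along the chain, at it only the
horizon error remains. Without a visit the estimate is 0 and the error at most 1/(1-γ). -/
lemma qValue_le_expect_omcSingle (z : S × A) (n : ℕ) (z₀ : S × A) :
    qValue M π z.1 z.2 ≤ expect (trajLaw M π n z₀) (fun x => omcSingle M x z)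
      + 1 / (1 - M.γ) * missWeight M π z n z₀ := by
  induction n generalizing z₀ with
  | zero =>
    have := expect_nonneg (trajLaw M π 0 z₀) fun x => omcSingle_nonneg M x z
    rw [missWeight]
    linarith [qValue_le M π z.1 z.2]
  | succ n ih =>
    by_cases h : z₀ = z
    · subst h
      rw [missWeight_self]
      refine (qValue_le_expect_discReturn M π (n + 1) z₀).trans (le_of_eq ?_)
      simp only [expect_trajLaw_succ, omcSingle_cons_self]
    · rw [missWeight, if_neg h]
      simp only [expect_trajLaw_succ, omcSingle_cons_of_ne M h]
      calc qValue M π z.1 z.2 = stepAvg M π (fun _ => qValue M π z.1 z.2) z₀ :=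
            (stepAvg_const M π _ z₀).symm
        _ ≤ _ := stepAvg_mono M π ih z₀
        _ = _ := by simp only [stepAvg, expect_add, expect_const_mul]

open Classical in
/-- The bias decays geometrically if every pair reaches `z` in `T` steps with probability at
least `p`. -/
lemma missWeight_le_exp (z : S × A) (T : ℕ) (p r : ℝ) (hT : 0 < T) (hp0 : 0 ≤ p) (hp1 : p ≤ 1)
    (hr0 : 0 ≤ r) (hrγ : r ≤ 1 - M.γ) (hrp : r * T ≤ p / 2)
    (hit : ∀ z₀, p ≤ (stepAvg M π)^[T] (fun z' => if z' = z then 1 else 0) z₀) (n : ℕ)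
    (z₀ : S × A) : missWeight M π z n z₀ ≤ 2 * Real.exp (-(r * n)) := by
  induction n using Nat.strong_induction_on generalizing z₀ with
  | _ n ih =>
    rcases lt_or_ge n T with hn | hn
    · refine (missWeight_le_one M π z n z₀).trans ?_
      have h1 : r * n ≤ r * T := mul_le_mul_of_nonneg_left (by exact_mod_cast hn.le) hr0
      have h2 := Real.add_one_le_exp (-(r * n))
      linarith
    · obtain ⟨n, rfl⟩ := Nat.exists_eq_add_of_le' hn
      set b := 2 * Real.exp (-(r * n)) with hb
      -- The factor 2 in the claim is chosen for this inequality and for the case n < T, where r n ≤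
      -- 1/2.
      have hγb : 2 * M.γ ^ n ≤ b := by
        have h1 : M.γ ≤ Real.exp (-r) := by
          linarith [Real.add_one_le_exp (-r)]
        have h2 := pow_le_pow_left₀ M.γ_pos.le h1 n
        rw [← Real.exp_nat_mul] at h2
        rw [hb, show -(r * n) = n * -r by ring]
        linarith
      have hγ0 : 0 < M.γ ^ n := pow_pos M.γ_pos n
      let f : S × A → ℝ := fun z' => if z' = z then 1 else 0
      have hf (z' : S × A) : 0 ≤ f z' := by simp only [f]; split_ifs <;> norm_num
      have hf1 (z' : S × A) : f z' ≤ 1 := by simp only [f]; split_ifs <;> norm_num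
      -- ψ bounds the bias with n steps left: γ^n at z, the inductive bound b elsewhere. Earlier
      -- visits only help, since they leave a power of γ at most γ^n ≤ ψ, so only the position after
      -- T steps matters.
      let ψ : S × A → ℝ := fun z' => b + -(b - M.γ ^ n) * f z'
      have hψ (z' : S × A) : M.γ ^ n ≤ ψ z' := by
        have := mul_le_mul_of_nonneg_left (hf1 z') (by linarith : 0 ≤ b - M.γ ^ n)
        simp only [ψ]
        linarith
      have key (j : ℕ) (z₀ : S × A) :
          missWeight M π z (n + j) z₀ ≤ (stepAvg M π)^[j] ψ z₀ := by
        induction j generalizing z₀ with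
        | zero =>
          by_cases h : z₀ = z
          · subst h
            rw [add_zero, missWeight_self]
            exact hψ _
          · refine (ih n (by omega) z₀).trans (le_of_eq ?_)
            simp [ψ, f, h, hb]
        | succ j ihj =>
          rw [Function.iterate_succ_apply', ← add_assoc, missWeight]
          split_ifs with h
          · calc M.γ ^ (n + j + 1) ≤ M.γ ^ n :=
                  pow_le_pow_of_le_one M.γ_pos.le M.γ_lt_one.le (by omega)
              _ = stepAvg M π (fun _ => M.γ ^ n) z₀ := (stepAvg_const M π _ z₀).symm
              _ ≤ _ := stepAvg_mono M π (fun z' => ?_) z₀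
            have h2 := stepAvg_iterate_mono M π hψ j z'
            have h3 := stepAvg_iterate_add_mul M π (M.γ ^ n) 0 ψ j z'
            simp only [zero_mul, add_zero] at h3
            linarith
          · exact stepAvg_mono M π ihj z₀
      refine (key T z₀).trans ?_
      rw [stepAvg_iterate_add_mul]
      have h1 := mul_le_mul_of_nonneg_left (hit z₀) (by linarith : 0 ≤ b - M.γ ^ n)
      have h2 : b * (1 - p / 2) ≤ b * Real.exp (-(r * T)) := by
        refine mul_le_mul_of_nonneg_left ?_ (by linarith)
        linarith [Real.add_one_le_exp (-(r * T))]
      have h3 : b * Real.exp (-(r * T)) = 2 * Real.exp (-(r * (n + T : ℕ))) := by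
        rw [hb, mul_assoc, ← Real.exp_add]
        push_cast
        ring_nf
      have h4 := mul_le_mul_of_nonneg_left hγb hp0
      rw [← h3]
      simp only [f] at *
      linarith

/-- The first step leaves the arbitrary initial pair, the other t are steps of the state chain;
mixing of states thus applies uniformly over initial pairs. -/
lemma stepAvg_iterate_succ (h : S × A → ℝ) (t : ℕ) (z : S × A) :
    (stepAvg M π)^[t + 1] h z = expect (M.P z.1 z.2) fun s =>
      ∑ s', (transition M π ^ t) s s' * expect (π s') fun a => h (s', a) := by
  induction t generalizing h with
  | zero => simp [stepAvg, Matrix.one_apply]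
  | succ t ih =>
    rw [Function.iterate_succ_apply, ih]
    congr 1
    funext s
    have h1 (s' : S) : (expect (π s') fun a => stepAvg M π h (s', a)) =
        ∑ s'', transition M π s' s'' * expect (π s'') fun a => h (s'', a) := by
      change ∑ a, (π s' a).toReal * ∑ s'', (M.P s' a s'').toReal * _ =
        ∑ s'', (∑ a, (π s' a).toReal * (M.P s' a s'').toReal) * _
      simp only [Finset.mul_sum, Finset.sum_mul]
      rw [Finset.sum_comm]
      simp only [mul_assoc]
    simp only [h1, pow_succ, Matrix.mul_apply, Finset.mul_sum, Finset.sum_mul, mul_assoc]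
    rw [Finset.sum_comm]

open Classical in
lemma mixing_hit (C ρ νmin : ℝ) (hmix : IsMixing M C ρ νmin π) (t : ℕ) (z z₀ : S × A) :
    (νmin - C * ρ ^ (t + 1)) * (π z.1 z.2).toReal ≤
      (stepAvg M π)^[t + 1] (fun z' => if z' = z then 1 else 0) z₀ := by
  obtain ⟨ν, -, h2, h3⟩ := hmix
  rw [stepAvg_iterate_succ]
  rw [← expect_const (M.P z₀.1 z₀.2) ((νmin - C * ρ ^ (t + 1)) * (π z.1 z.2).toReal)]
  refine expect_mono _ fun s => ?_
  have h4 (s' : S) : (expect (π s') fun a => if (s', a) = z then (1 : ℝ) else 0) =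
      if s' = z.1 then (π z.1 z.2).toReal else 0 := by
    by_cases hs : s' = z.1
    · subst hs
      rw [if_pos rfl, expect, Finset.sum_eq_single z.2]
      · simp
      · intro a _ ha
        rw [if_neg (fun h => ha (congrArg Prod.snd h)), mul_zero]
      · simp
    · rw [if_neg hs, expect]
      refine Finset.sum_eq_zero fun a _ => ?_
      rw [if_neg (fun h => hs (congrArg Prod.fst h)), mul_zero]
  simp only [h4, mul_ite, mul_zero, Finset.sum_ite_eq', Finset.mem_univ, if_true]
  refine mul_le_mul_of_nonneg_right ?_ ENNReal.toReal_nonneg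
  have h5 := (Finset.single_le_sum (f := fun x => |(transition M π ^ t) s x - (ν x).toReal|)
    (fun _ _ => abs_nonneg _) (Finset.mem_univ z.1)).trans (h2 s t)
  have h6 := (abs_le.1 h5).1
  linarith [h3 z.1]

end Bias

/-! ### Chernoff bounds for one batch -/

section Concentration

/-- Average exp u ≤ 1 + u + u², valid for |u| ≤ 1; the centred linear term vanishes. -/
lemma expect_exp_sub_expect_le {α : Type*} [Fintype α] (p : PMF α) (X : α → ℝ) (B l : ℝ)
    (h0 : ∀ x, 0 ≤ X x) (hB : ∀ x, X x ≤ B) (hl : |l| * B ≤ 1) :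
    expect p (fun x => Real.exp (l * (X x - expect p X))) ≤ Real.exp (l ^ 2 * B ^ 2) := by
  have hμ0 := expect_nonneg p h0
  have hμB := expect_le p hB
  have h1 (x : α) : Real.exp (l * (X x - expect p X)) ≤
      (1 + l ^ 2 * B ^ 2) + l * (X x - expect p X) := by
    have h2 : |X x - expect p X| ≤ B := abs_le.2 ⟨by linarith [h0 x], by linarith [hB x]⟩
    have h3 : |l * (X x - expect p X)| ≤ 1 := by
      rw [abs_mul]
      exact (mul_le_mul_of_nonneg_left h2 (abs_nonneg l)).trans hl
    have h4 := (abs_le.1 (Real.abs_exp_sub_one_sub_id_le h3)).2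
    have h5 : (l * (X x - expect p X)) ^ 2 ≤ l ^ 2 * B ^ 2 := by
      rw [mul_pow]
      exact mul_le_mul_of_nonneg_left (sq_le_sq.2 (h2.trans (le_abs_self B))) (sq_nonneg l)
    linarith
  refine (expect_mono p h1).trans ?_
  rw [expect_add, expect_const, expect_const_mul, expect_sub, expect_const, sub_self, mul_zero,
    add_zero, add_comm]
  exact Real.add_one_le_exp _

variable {S : Type u} {A : Type v} [Fintype S] [Fintype A] (M : MDP S A) (π : Policy S A)

/-- Independence makes the moment factorize. Each trajectory is centred at its own mean because
initial pairs may differ. -/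
lemma expect_batchLaw_exp_le (n : ℕ) (X : (Fin n → S × A) → ℝ) (B l : ℝ)
    (h0 : ∀ x, 0 ≤ X x) (hB : ∀ x, X x ≤ B) (hl : |l| * B ≤ 1) (m : ℕ) (z : Fin m → S × A) :
    expect (batchLaw M π n m z)
      (fun b => Real.exp (l * ∑ i, (X (b i) - expect (trajLaw M π n (z i)) X))) ≤
      Real.exp (m * (l ^ 2 * B ^ 2)) := by
  induction m with
  | zero => simp [batchLaw, expect_pure]
  | succ m ih =>
    simp only [batchLaw, expect_bind, expect_map, Fin.sum_univ_succ, Fin.cons_zero, Fin.cons_succ,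
      mul_add, Real.exp_add, expect_const_mul, expect_mul_const]
    have h1 := expect_exp_sub_expect_le (trajLaw M π n (z 0)) X B l h0 hB hl
    have h2 := ih (Fin.tail z)
    push_cast
    rw [add_mul, Real.exp_add, one_mul, mul_comm (Real.exp (m * _))]
    exact mul_le_mul h1 h2 (expect_nonneg _ fun _ => (Real.exp_pos _).le) (Real.exp_pos _).le

lemma expect_batchLaw_deviation_le (n : ℕ) (X : (Fin n → S × A) → ℝ) (B e : ℝ)
    (h0 : ∀ x, 0 ≤ X x) (hB : ∀ x, X x ≤ B) (he : 0 < e) (heB : e ≤ 2 * B) (m : ℕ)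
    (z : Fin m → S × A) :
    expect (batchLaw M π n m z) (Set.indicator
      {b | m * e < |∑ i, (X (b i) - expect (trajLaw M π n (z i)) X)|} fun _ => 1) ≤
      2 * Real.exp (-(m * e ^ 2 / (4 * B ^ 2))) := by
  have hB0 : 0 < B := by linarith
  let D : Batch S A m n → ℝ := fun b => ∑ i, (X (b i) - expect (trajLaw M π n (z i)) X)
  -- The minimizer of -l e + l² B²; the hypothesis e ≤ 2B keeps l B ≤ 1.
  set l := e / (2 * B ^ 2) with hl
  have hl0 : 0 < l := by positivity
  have hlB : |l| * B ≤ 1 := by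
    rw [abs_of_pos hl0, hl, div_mul_eq_mul_div, div_le_one (by positivity)]
    nlinarith
  have h1 := expect_batchLaw_exp_le M π n X B l h0 hB hlB m z
  have h2 := expect_batchLaw_exp_le M π n X B (-l) h0 hB (by rwa [abs_neg]) m z
  have h3 : ∀ b, Set.indicator {b | m * e < |D b|} (fun _ => (1 : ℝ)) b ≤
      Real.exp (-(l * (m * e))) * (Real.exp (l * D b) + Real.exp (-l * D b)) := by
    intro b
    rw [mul_add, ← Real.exp_add, ← Real.exp_add]
    by_cases hb : m * e < |D b|
    · rw [Set.indicator_of_mem (by exact hb)]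
      rcases lt_abs.1 hb with h | h
      · have h4 : 1 ≤ Real.exp (-(l * (m * e)) + l * D b) :=
          Real.one_le_exp (by nlinarith)
        linarith [Real.exp_pos (-(l * (m * e)) + -l * D b)]
      · have h4 : 1 ≤ Real.exp (-(l * (m * e)) + -l * D b) :=
          Real.one_le_exp (by nlinarith)
        linarith [Real.exp_pos (-(l * (m * e)) + l * D b)]
    · rw [Set.indicator_of_notMem (by exact hb)]
      positivity
  refine (expect_mono _ h3).trans ?_
  rw [expect_const_mul, expect_add]
  have h5 : -(m * e ^ 2 / (4 * B ^ 2)) = -(l * (m * e)) + m * (l ^ 2 * B ^ 2) := by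
    rw [hl]; field_simp; ring
  rw [h5, Real.exp_add, mul_left_comm 2]
  refine mul_le_mul_of_nonneg_left ?_ (Real.exp_pos _).le
  rw [neg_sq] at h2
  linarith

variable [DecidableEq S]

/-- The batch estimates all values that are not truncated up to an error `e`. -/
def Accurate (τ e : ℝ) {m n : ℕ} (b : Batch S A m n) : Prop :=
  ∀ s a, τ ≤ (π s a).toReal → |omc M b s a - qValue M π s a| ≤ e

/-- Half of e is spent on the deviation from the mean, half on the bias, followed by a union bound
over all pairs. -/
lemma expect_batchLaw_not_accurate_le (τ e : ℝ) (m n : ℕ) (hm : 0 < m) (he : 0 < e)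
    (heB : e ≤ 2 / (1 - M.γ))
    (hbias : ∀ z z₀ : S × A, τ ≤ (π z.1 z.2).toReal →
      1 / (1 - M.γ) * missWeight M π z n z₀ ≤ e / 2) (z₀ : Fin m → S × A) :
    expect (batchLaw M π n m z₀) (Set.indicator {b | ¬ Accurate M π τ e b} fun _ => 1) ≤
      Fintype.card S * Fintype.card A *
        (2 * Real.exp (-(m * e ^ 2 * (1 - M.γ) ^ 2 / 16))) := by
  have hγ := one_sub_γ_pos M
  have hm' : (0 : ℝ) < m := by exact_mod_cast hm
  let E (z : S × A) : Set (Batch S A m n) := {b | m * (e / 2) <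
    |∑ i, (omcSingle M (b i) z - expect (trajLaw M π n (z₀ i)) fun x => omcSingle M x z)|}
  have hE (z : S × A) : expect (batchLaw M π n m z₀) ((E z).indicator fun _ => 1) ≤
      2 * Real.exp (-(m * e ^ 2 * (1 - M.γ) ^ 2 / 16)) := by
    refine (expect_batchLaw_deviation_le M π n (fun x => omcSingle M x z) (1 / (1 - M.γ)) (e / 2)
      (fun x => omcSingle_nonneg M x z) (fun x => omcSingle_le M x z) (by linarith)
      (by rw [mul_one_div]; linarith) m
      z₀).trans_eq ?_
    congr 3
    field_simp
    ring
  have hsub (b : Batch S A m n) (hb : ¬ Accurate M π τ e b) : ∃ z, b ∈ E z := by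
    by_contra! hne
    refine hb fun s a hsa => ?_
    have h1 : |∑ i, (omcSingle M (b i) (s, a) -
        expect (trajLaw M π n (z₀ i)) fun x => omcSingle M x (s, a))| ≤ m * (e / 2) :=
      not_lt.1 (hne (s, a))
    have h2 : |∑ i, ((expect (trajLaw M π n (z₀ i)) fun x => omcSingle M x (s, a))
        - qValue M π s a)| ≤ m * (e / 2) := by
      refine (Finset.abs_sum_le_sum_abs _ _).trans ?_
      calc _ ≤ ∑ _i : Fin m, e / 2 := Finset.sum_le_sum fun i _ => ?_
        _ = _ := by simp
      have h3 := expect_omcSingle_le M π (s, a) n (z₀ i)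
      have h4 := qValue_le_expect_omcSingle M π (s, a) n (z₀ i)
      rw [abs_le]
      constructor <;> linarith [hbias (s, a) (z₀ i) hsa]
    have h5 : omc M b s a - qValue M π s a = (1 / (m : ℝ)) *
        (∑ i, (omcSingle M (b i) (s, a) -
          expect (trajLaw M π n (z₀ i)) fun x => omcSingle M x (s, a)) +
        ∑ i, ((expect (trajLaw M π n (z₀ i)) fun x => omcSingle M x (s, a))
        - qValue M π s a)) := by
      rw [omc, ← Finset.sum_add_distrib]
      simp only [sub_add_sub_cancel, Finset.sum_sub_distrib, Finset.sum_const, Finset.card_univ,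
        Fintype.card_fin, nsmul_eq_mul]
      field_simp
    rw [h5, abs_mul, abs_of_pos (by positivity), one_div, inv_mul_le_iff₀ hm']
    exact (abs_add_le _ _).trans (by linarith)
  have hind (b : Batch S A m n) : Set.indicator {b | ¬ Accurate M π τ e b} (fun _ => (1 : ℝ)) b ≤
      ∑ z, (E z).indicator (fun _ => 1) b := by
    have hnn (z : S × A) : 0 ≤ (E z).indicator (fun _ => (1 : ℝ)) b :=
      Set.indicator_nonneg (by simp) b
    by_cases hb : Accurate M π τ e b
    · rw [Set.indicator_of_notMem (not_not.2 hb)]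
      exact Finset.sum_nonneg fun z _ => hnn z
    · obtain ⟨z, hz⟩ := hsub b hb
      rw [Set.indicator_of_mem (by exact hb)]
      refine le_trans ?_ (Finset.single_le_sum (f := fun z => (E z).indicator (fun _ => (1 : ℝ)) b)
        (fun z _ => hnn z) (Finset.mem_univ z))
      simp [hz]
  refine (expect_mono _ hind).trans ?_
  have hswap : (expect (batchLaw M π n m z₀) fun b => ∑ z, (E z).indicator (fun _ => 1) b) =
      ∑ z, expect (batchLaw M π n m z₀) ((E z).indicator fun _ => 1) := by
    simp only [expect, Finset.mul_sum]
    exact Finset.sum_comm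
  rw [hswap]
  refine (Finset.sum_le_sum fun z _ => hE z).trans_eq ?_
  simp [Fintype.card_prod]

end Concentration

/-! ### Union bound along an adaptive run -/

section Run

lemma toOuterMeasure_univ {α : Type*} (p : PMF α) : p.toOuterMeasure Set.univ = 1 :=
  (p.toOuterMeasure_apply_eq_one_iff Set.univ).2 (Set.subset_univ _)

lemma toOuterMeasure_le_one {α : Type*} (p : PMF α) (E : Set α) : p.toOuterMeasure E ≤ 1 :=
  (MeasureTheory.OuterMeasure.mono _ (Set.subset_univ E)).trans_eq (toOuterMeasure_univ p)

lemma one_sub_le_toOuterMeasure {α : Type*} (p : PMF α) (B G : Set α) (c : ENNReal)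
    (hB : p.toOuterMeasure B ≤ c) (h : ∀ x ∈ p.support, x ∉ B → x ∈ G) :
    1 - c ≤ p.toOuterMeasure G := by
  have h1 : p.toOuterMeasure Set.univ ≤ p.toOuterMeasure (B ∪ G) := by
    refine p.toOuterMeasure_mono fun x hx => ?_
    by_cases hxB : x ∈ B
    · exact Or.inl hxB
    · exact Or.inr (h x hx.2 hxB)
  rw [toOuterMeasure_univ] at h1
  rw [tsub_le_iff_left]
  exact h1.trans ((MeasureTheory.measure_union_le _ _).trans (by gcongr))

variable {S : Type u} {A : Type v} [Fintype A] [Nonempty A] (M : MDP S A) (η τ : ℝ) {m n : ℕ}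
  (init : List (Batch S A m n) → PMF (Fin m → S × A))

lemma policyAfter_append (h : List (Batch S A m n)) (b : Batch S A m n) :
    policyAfter M η τ (h ++ [b]) = fun s => mirrorStep η (tomc M τ (policyAfter M η τ h) b s)
      (policyAfter M η τ h s) := by
  simp [policyAfter, List.foldl_append]

lemma length_of_mem_support_runLaw (k : ℕ) (h : List (Batch S A m n))
    (hh : h ∈ (runLaw M η τ init k).support) : h.length = k := by
  induction k generalizing h with
  | zero => simp_all [runLaw]
  | succ k ih =>
    simp only [runLaw, PMF.mem_support_bind_iff, PMF.mem_support_map_iff] at hh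
    obtain ⟨h', hh', b, -, rfl⟩ := hh
    simp [ih h' hh']

/-- Mixing is assumed along complete runs; this transfers it to every history that can occur at an
intermediate time. -/
lemma exists_extension_mem_support_runLaw (i j : ℕ) (h : List (Batch S A m n))
    (hh : h ∈ (runLaw M η τ init i).support) :
    ∃ h' ∈ (runLaw M η τ init (i + j)).support, h'.take i = h := by
  induction j with
  | zero => exact ⟨h, hh, List.take_of_length_le (length_of_mem_support_runLaw M η τ init i h hh).le⟩
  | succ j ih =>
    obtain ⟨h', hh', he⟩ := ih
    obtain ⟨b, hb⟩ := ((init h').bind fun z =>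
      batchLaw M (policyAfter M η τ h') n m z).support_nonempty
    refine ⟨h' ++ [b], ?_, ?_⟩
    · rw [← add_assoc, runLaw, PMF.mem_support_bind_iff]
      exact ⟨h', hh', (PMF.mem_support_map_iff _ _ _).2 ⟨b, hb, rfl⟩⟩
    · rw [List.take_append_of_le_length, he]
      rw [length_of_mem_support_runLaw M η τ init _ h' hh']
      omega

/-- Some batch of the run fails a property relating it to the policy which generated it. -/
def badRun (acc : Policy S A → Batch S A m n → Prop) : Set (List (Batch S A m n)) :=
  {h | ∃ t, ∃ ht : t < h.length, ¬ acc (policyAfter M η τ (h.take t)) h[t]}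

lemma mem_badRun_append (acc : Policy S A → Batch S A m n → Prop) (h : List (Batch S A m n))
    (b : Batch S A m n) (hb : h ++ [b] ∈ badRun M η τ acc) :
    h ∈ badRun M η τ acc ∨ ¬ acc (policyAfter M η τ h) b := by
  obtain ⟨t, ht, hacc⟩ := hb
  rcases lt_or_ge t h.length with hlt | hge
  · left
    refine ⟨t, hlt, ?_⟩
    rwa [List.take_append_of_le_length hlt.le, List.getElem_append_left hlt] at hacc
  · right
    have : t = h.length := by simp at ht; omega
    subst this
    simpa using hacc

/-- Union bound over the iterations of a run. -/
lemma toOuterMeasure_badRun_le (acc : Policy S A → Batch S A m n → Prop) (c : ENNReal) (k : ℕ)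
    (hc : ∀ i < k, ∀ h ∈ (runLaw M η τ init i).support,
      ((init h).bind fun z => batchLaw M (policyAfter M η τ h) n m z).toOuterMeasure
        {b | ¬ acc (policyAfter M η τ h) b} ≤ c) :
    (runLaw M η τ init k).toOuterMeasure (badRun M η τ acc) ≤ k * c := by
  classical
  induction k with
  | zero =>
    have h : ([] : List (Batch S A m n)) ∉ badRun M η τ acc := by
      rintro ⟨t, ht, -⟩
      exact absurd ht (Nat.not_lt_zero t)
    simp [runLaw, PMF.toOuterMeasure_pure_apply, h]
  | succ k ih =>
    have ih := ih fun i hi => hc i (by omega)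
    rw [runLaw, PMF.toOuterMeasure_bind_apply]
    set q := fun h => (init h).bind fun z => batchLaw M (policyAfter M η τ h) n m z with hq
    -- A history that is already bad is charged in full; after a good one only the new batch can
    -- fail, with conditional probability at most c.
    calc _ ≤ ∑' h, ((badRun M η τ acc).indicator (runLaw M η τ init k) h
            + runLaw M η τ init k h * c) := ENNReal.tsum_le_tsum fun h => ?_
      _ = (runLaw M η τ init k).toOuterMeasure (badRun M η τ acc) + c := by
          rw [ENNReal.tsum_add, ENNReal.tsum_mul_right, PMF.tsum_coe, one_mul,
            PMF.toOuterMeasure_apply]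
      _ ≤ _ := by
          push_cast
          rw [add_mul, one_mul]
          gcongr
    by_cases hs : runLaw M η τ init k h = 0
    · simp [hs]
    · rw [← ne_eq, ← PMF.mem_support_iff] at hs
      by_cases hb : h ∈ badRun M η τ acc
      · rw [Set.indicator_of_mem hb]
        refine le_trans (mul_le_of_le_one_right' ?_) le_self_add
        exact toOuterMeasure_le_one _ _
      · rw [Set.indicator_of_notMem hb, zero_add]
        gcongr
        rw [PMF.toOuterMeasure_map_apply]
        refine le_trans (MeasureTheory.OuterMeasure.mono _ fun b hb' => ?_) (hc k (by omega) h hs)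
        exact (mem_badRun_append M η τ acc h b hb').resolve_left hb

end Run

/-! ### Stepsize, noise level, batch size and trajectory length -/

section ParameterBounds

lemma rpow_three_halves {a : ℝ} (ha : 0 ≤ a) : a ^ (3 / 2 : ℝ) = a * √a := by
  rw [Real.sqrt_eq_rpow, show (3 / 2 : ℝ) = 1 + 1 / 2 by norm_num,
    Real.rpow_add_of_nonneg ha (by norm_num) (by norm_num), Real.rpow_one]

lemma mixTime_pos (γ C ρ νmin : ℝ) (a : ℕ) : 0 < mixTime γ C ρ νmin a :=
  lt_of_lt_of_le one_pos (le_max_left _ _)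

lemma mul_pow_mixTime_le {γ C ρ νmin : ℝ} {a : ℕ} (hγ0 : 0 < γ) (hγ1 : γ < 1) (hC : 0 < C)
    (hρ0 : 0 < ρ) (hρ1 : ρ < 1) (hν : 0 < νmin) (ha : 0 < a) :
    C * ρ ^ mixTime γ C ρ νmin a ≤ νmin / 2 := by
  have ha' : (1 : ℝ) ≤ a := by exact_mod_cast ha
  have hγ : 0 < 1 - γ := by linarith
  set x := νmin * (1 - γ) ^ 2 / (32 * C * a) with hx
  have hx0 : 0 < x := by positivity
  have h1 : Real.logb ρ x ≤ (mixTime γ C ρ νmin a : ℕ) :=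
    (Nat.le_ceil _).trans (by exact_mod_cast le_max_right _ _)
  have h2 := Real.rpow_le_rpow_of_exponent_ge hρ0 hρ1.le h1
  rw [Real.rpow_logb hρ0 hρ1.ne hx0, Real.rpow_natCast] at h2
  refine (mul_le_mul_of_nonneg_left h2 hC.le).trans ?_
  rw [hx, mul_div_assoc', div_le_div_iff₀ (by positivity) (by norm_num)]
  have h3 : (1 - γ) ^ 2 ≤ 1 := pow_le_one₀ hγ.le (by linarith)
  have h4 : νmin * (1 - γ) ^ 2 * C ≤ νmin * 1 * C := by gcongr
  have h5 : νmin * C ≤ νmin * C * a := le_mul_of_one_le_right (by positivity) ha'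
  nlinarith [mul_pos hν hC]

lemma inv_le_horizonFactor {γ C ρ νmin : ℝ} {a : ℕ} (hγ1 : γ < 1) (hν : 0 < νmin) :
    1 / (1 - γ) ≤ horizonFactor γ C ρ νmin a := by
  have hγ : 0 < 1 - γ := by linarith
  rw [horizonFactor]
  have : 0 ≤ mixTime γ C ρ νmin a * a / (νmin * (1 - γ) ^ 2) := by positivity
  linarith

lemma horizonFactor_pos {γ C ρ νmin : ℝ} {a : ℕ} (hγ1 : γ < 1) (hν : 0 < νmin) :
    0 < horizonFactor γ C ρ νmin a :=
  lt_of_lt_of_le (one_div_pos.2 (by linarith)) (inv_le_horizonFactor hγ1 hν)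

variable {γ : ℝ} {a k : ℕ}

lemma noiseLevel_pos (hγ1 : γ < 1) (ha : 2 ≤ a) (hk : 0 < k) : 0 < noiseLevel γ a k := by
  have hγ : 0 < 1 - γ := by linarith
  have ha' : (2 : ℝ) ≤ a := by exact_mod_cast ha
  have hk' : (0 : ℝ) < k := by exact_mod_cast hk
  have hR : 0 < √(a : ℝ) - 1 := by
    rw [sub_pos, Real.lt_sqrt] <;> linarith
  rw [noiseLevel]
  positivity

lemma noiseLevel_sq (ha : 2 ≤ a) :
    noiseLevel γ a k ^ 2 = (1 / (1 - γ)) ^ 2 * (2 * a * (√a - 1) / k) := by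
  have ha' : (2 : ℝ) ≤ a := by exact_mod_cast ha
  have hR : 0 ≤ √(a : ℝ) - 1 := by
    rw [sub_nonneg, Real.one_le_sqrt]; linarith
  rw [noiseLevel, mul_pow, Real.sq_sqrt (by positivity)]

lemma noiseLevel_le (hγ1 : γ < 1) (ha : 2 ≤ a) (hk : 0 < k) :
    noiseLevel γ a k ≤ 2 * (1 / (1 - γ) * √((a : ℝ) ^ (3 / 2 : ℝ) / k)) := by
  have hγ : 0 < 1 - γ := by linarith
  have hk' : (0 : ℝ) < k := by exact_mod_cast hk
  rw [noiseLevel, mul_left_comm]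
  refine mul_le_mul_of_nonneg_left ?_ (by positivity)
  rw [show (2 : ℝ) = √(2 ^ 2) by rw [Real.sqrt_sq]; norm_num, ← Real.sqrt_mul (by positivity),
    Real.sqrt_sq (by norm_num)]
  refine Real.sqrt_le_sqrt ?_
  rw [rpow_three_halves (Nat.cast_nonneg a), mul_div_assoc']
  refine div_le_div_of_nonneg_right ?_ hk'.le
  have : 0 ≤ (a : ℝ) * √a := by positivity
  nlinarith [(Nat.cast_nonneg a : (0 : ℝ) ≤ a)]

lemma stepsize_pos (hγ1 : γ < 1) (ha : 2 ≤ a) (hk : 0 < k) : 0 < stepsize γ a k := by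
  have hγ : 0 < 1 - γ := by linarith
  have ha' : (2 : ℝ) ≤ a := by exact_mod_cast ha
  have hk' : (0 : ℝ) < k := by exact_mod_cast hk
  have hR : 0 < √(a : ℝ) - 1 := by
    rw [sub_pos, Real.lt_sqrt] <;> linarith
  rw [stepsize]
  positivity

lemma mul_stepsize_sq (hγ1 : γ < 1) (ha : 2 ≤ a) (hk : 0 < k) :
    k * (stepsize γ a k ^ 2 * (1 / (1 - γ)) ^ 2) = (√a - 1) / (8 * a) := by
  have hγ : 0 < 1 - γ := by linarith
  have ha' : (2 : ℝ) ≤ a := by exact_mod_cast ha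
  have hk' : (0 : ℝ) < k := by exact_mod_cast hk
  have hR : 0 ≤ √(a : ℝ) - 1 := by
    rw [sub_nonneg, Real.one_le_sqrt]; linarith
  rw [stepsize, Real.sq_sqrt (by positivity)]
  field_simp

/-- The balance behind the parameters: the total noise cost is comparable to the initial divergence
√a - 1. -/
lemma mul_stepsize_mul_noiseLevel (hγ1 : γ < 1) (ha : 2 ≤ a) (hk : 0 < k) :
    k * stepsize γ a k * noiseLevel γ a k = (√a - 1) / 2 := by
  have ha' : (2 : ℝ) ≤ a := by exact_mod_cast ha
  have hk' : (0 : ℝ) < k := by exact_mod_cast hk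
  have hR : 0 ≤ √(a : ℝ) - 1 := by
    rw [sub_nonneg, Real.one_le_sqrt]; linarith
  refine (sq_eq_sq₀ ?_ (by positivity)).1 ?_
  · exact mul_nonneg (mul_nonneg hk'.le (stepsize_pos hγ1 ha hk).le) (noiseLevel_pos hγ1 ha hk).le
  · have h := mul_stepsize_sq hγ1 ha hk
    rw [mul_pow, noiseLevel_sq ha, mul_pow]
    calc _ = k * (stepsize γ a k ^ 2 * (1 / (1 - γ)) ^ 2) * (2 * a * (√a - 1)) := by
          field_simp
      _ = _ := by
          rw [h]
          field_simp
          ring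

/-- The stepsize term takes at most 1/8 and the noise term 1/4 of √a - 1. -/
lemma regret_budget (hγ1 : γ < 1) (ha : 2 ≤ a) (hk : 0 < k) :
    k * (2 * stepsize γ a k ^ 2 * (1 / (1 - γ)) ^ 2
      + 2 * stepsize γ a k * (noiseLevel γ a k / 4)) ≤ (√a - 1) / 2 := by
  have h1 := mul_stepsize_sq hγ1 ha hk
  have h2 := mul_stepsize_mul_noiseLevel hγ1 ha hk
  have ha' : (2 : ℝ) ≤ a := by exact_mod_cast ha
  have hR : 0 ≤ √(a : ℝ) - 1 := by
    rw [sub_nonneg, Real.one_le_sqrt]; linarith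
  have h3 : (√(a : ℝ) - 1) / (8 * a) ≤ (√a - 1) / 8 := by
    gcongr
    linarith
  linarith

lemma regret_rate (hγ1 : γ < 1) (ha : 2 ≤ a) (hk : 0 < k) :
    1 / (1 - γ) * (3 / 2 * (√a - 1)) / (k * stepsize γ a k) ≤
      12 * (1 / (1 - γ)) / (1 - γ) * √((a : ℝ) ^ (3 / 2 : ℝ) / k) := by
  have hγ : 0 < 1 - γ := by linarith
  have hk' : (0 : ℝ) < k := by exact_mod_cast hk
  have hη := stepsize_pos hγ1 ha hk
  have h1 : 1 / (1 - γ) * (3 / 2 * (√a - 1)) / (k * stepsize γ a k) =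
      1 / (1 - γ) * 3 * noiseLevel γ a k := by
    rw [div_eq_iff (by positivity)]
    linear_combination (-3 * (1 / (1 - γ))) * mul_stepsize_mul_noiseLevel hγ1 ha hk
  rw [h1]
  have h2 := mul_le_mul_of_nonneg_left (noiseLevel_le hγ1 ha hk)
    (by positivity : 0 ≤ 1 / (1 - γ) * 3)
  have h3 : 0 ≤ 1 / (1 - γ) * (1 / (1 - γ)) * √((a : ℝ) ^ (3 / 2 : ℝ) / k) := by positivity
  have h4 : 12 * (1 / (1 - γ)) / (1 - γ) * √((a : ℝ) ^ (3 / 2 : ℝ) / k) =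
    12 * (1 / (1 - γ) * (1 / (1 - γ)) * √((a : ℝ) ^ (3 / 2 : ℝ) / k)) := by ring
  linarith

/-- For few iterations the rate exceeds the trivial bound 1/(1-γ) on any gap. -/
lemma le_rate_of_small (hγ1 : γ < 1) (hk : 0 < k)
    (h : (k : ℝ) ≤ 144 * (1 / (1 - γ)) ^ 2 * (a : ℝ) ^ (3 / 2 : ℝ)) :
    1 / (1 - γ) ≤ 12 * (1 / (1 - γ)) / (1 - γ) * √((a : ℝ) ^ (3 / 2 : ℝ) / k) := by
  have hγ : 0 < 1 - γ := by linarith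
  have hk' : (0 : ℝ) < k := by exact_mod_cast hk
  have h1 : 1 ≤ 12 * (1 / (1 - γ)) * √((a : ℝ) ^ (3 / 2 : ℝ) / k) := by
    rw [← one_le_sq_iff₀ (by positivity), mul_pow, Real.sq_sqrt (by positivity), mul_div_assoc',
      le_div_iff₀ hk']
    linarith
  have h2 := mul_le_mul_of_nonneg_left h1 (by positivity : 0 ≤ 1 / (1 - γ))
  calc _ = 1 / (1 - γ) * 1 := (mul_one _).symm
    _ ≤ _ := h2
    _ = _ := by ring

lemma noiseLevel_le_of_large (hγ1 : γ < 1) (ha : 2 ≤ a) (hk : 0 < k)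
    (h : 144 * (1 / (1 - γ)) ^ 2 * (a : ℝ) ^ (3 / 2 : ℝ) ≤ k) : noiseLevel γ a k ≤ 1 / 8 := by
  have hγ : 0 < 1 - γ := by linarith
  have hk' : (0 : ℝ) < k := by exact_mod_cast hk
  have ha' : (2 : ℝ) ≤ a := by exact_mod_cast ha
  rw [rpow_three_halves (Nat.cast_nonneg a)] at h
  rw [← pow_le_pow_iff_left₀ (noiseLevel_pos hγ1 ha hk).le (by norm_num) two_ne_zero,
    noiseLevel_sq ha, mul_div_assoc', div_le_iff₀ hk']
  have h1 : 0 ≤ (1 / (1 - γ)) ^ 2 * a := by positivity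
  have h2 : 0 ≤ (1 / (1 - γ)) ^ 2 * a * √a := by positivity
  nlinarith

lemma sample_size_suffices {δ m : ℝ} {cS : ℕ} (hγ1 : γ < 1) (ha : 2 ≤ a) (hk : 0 < k)
    (hS : 0 < cS) (hδ0 : 0 < δ) (hδ1 : δ < 1) (hm : 1024 * mScale γ δ cS a k ≤ m) :
    cS * a * (2 * Real.exp (-(m * (noiseLevel γ a k / 4) ^ 2 * (1 - γ) ^ 2 / 16))) ≤ δ / k := by
  have hγ : 0 < 1 - γ := by linarith
  have hk' : (1 : ℝ) ≤ k := by exact_mod_cast hk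
  have ha' : (2 : ℝ) ≤ a := by exact_mod_cast ha
  have hS' : (1 : ℝ) ≤ cS := by exact_mod_cast hS
  have hN := noiseLevel_pos hγ1 ha hk
  set X := 2 * (cS * a) * k / δ with hX
  have hX1 : 1 ≤ X := by
    rw [hX, le_div_iff₀ hδ0]
    have h1 : (1 : ℝ) * 1 ≤ cS * a := by gcongr; linarith
    have h2 : (1 : ℝ) * 1 ≤ (cS * a) * k := by gcongr; linarith
    linarith
  have hlog : 0 ≤ Real.log X := Real.log_nonneg hX1
  have h1 : Real.log X ≤ m * (noiseLevel γ a k / 4) ^ 2 * (1 - γ) ^ 2 / 16 := by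
    have h2 : 1024 * mScale γ δ cS a k * ((noiseLevel γ a k / 4) ^ 2 * (1 - γ) ^ 2 / 16) ≤
        m * ((noiseLevel γ a k / 4) ^ 2 * (1 - γ) ^ 2 / 16) :=
      mul_le_mul_of_nonneg_right hm (by positivity)
    -- 1024 = 4 · 16 · 16: one 16 from the accuracy ε/4, one from the Chernoff exponent.
    have h3 : 1024 * mScale γ δ cS a k * ((noiseLevel γ a k / 4) ^ 2 * (1 - γ) ^ 2 / 16) =
        4 * a ^ 2 * Real.log X := by
      rw [mScale, ← hX]
      field_simp
      ring
    have h4 : Real.log X ≤ 4 * a ^ 2 * Real.log X := le_mul_of_one_le_left hlog (by nlinarith)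
    linarith
  have h2 : Real.exp (-(m * (noiseLevel γ a k / 4) ^ 2 * (1 - γ) ^ 2 / 16)) ≤ X⁻¹ := by
    rw [← Real.exp_log (inv_pos.2 (by linarith : 0 < X)), Real.log_inv]
    exact Real.exp_le_exp.2 (neg_le_neg h1)
  calc _ ≤ cS * a * (2 * X⁻¹) := by gcongr
    _ = δ / k := by
      rw [hX]
      field_simp

lemma one_le_log_of_large (hγ1 : γ < 1) (ha : 2 ≤ a) (hk : 0 < k)
    (h : noiseLevel γ a k ≤ 1 / 8) : 1 ≤ Real.log (a / noiseLevel γ a k) := by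
  have ha' : (2 : ℝ) ≤ a := by exact_mod_cast ha
  have hN := noiseLevel_pos hγ1 ha hk
  rw [Real.le_log_iff_exp_le (by positivity), le_div_iff₀ hN]
  have := Real.exp_one_lt_d9
  nlinarith [Real.exp_pos 1]

lemma one_le_log_exp_add {x : ℝ} (hx : 0 ≤ x) : 1 ≤ Real.log (Real.exp 1 + x) := by
  rw [Real.le_log_iff_exp_le (by positivity)]
  linarith

/-- The exponent must beat log(16B/N). Its part log B is not controlled by log(a/N) but by log(e + L
log(a/N)), since L ≥ B; this costs one polylogarithmic factor. -/
lemma length_suffices {C ρ νmin n : ℝ} (hγ1 : γ < 1) (ha : 2 ≤ a) (hk : 0 < k)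
    (hν : 0 < νmin) (hN8 : noiseLevel γ a k ≤ 1 / 8)
    (hn : 1024 * polylog 1 (nScale γ C ρ νmin a k) ≤ n) :
    1 / (1 - γ) * (2 * Real.exp (-(1 / (64 * horizonFactor γ C ρ νmin a) * n))) ≤
      noiseLevel γ a k / 4 / 2 := by
  have hγ : 0 < 1 - γ := by linarith
  have ha' : (2 : ℝ) ≤ a := by exact_mod_cast ha
  have hN := noiseLevel_pos hγ1 ha hk
  have hL := horizonFactor_pos (C := C) (ρ := ρ) (a := a) hγ1 hν
  have hB := inv_le_horizonFactor (C := C) (ρ := ρ) (a := a) hγ1 hν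
  have hℓ := one_le_log_of_large hγ1 ha hk hN8
  set N := noiseLevel γ a k
  set L := horizonFactor γ C ρ νmin a
  set B := 1 / (1 - γ) with hBdef
  have hB0 : 0 < B := by positivity
  set l := Real.log (a / N) with hl
  have hx : nScale γ C ρ νmin a k = L * l := rfl
  set g := Real.log (Real.exp 1 + L * l) with hg
  have hg1 : 1 ≤ g := one_le_log_exp_add (by positivity)
  rw [polylog, pow_one, hx, ← hg] at hn
  have hBL : B ≤ L * l := hB.trans (le_mul_of_one_le_right hL.le hℓ)
  have h1 : Real.log (16 * B / N) ≤ 16 * l * g := by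
    have e1 : Real.log (16 * B / N) = Real.log 16 + Real.log B + (l - Real.log a) := by
      rw [hl, Real.log_div (by positivity) hN.ne', Real.log_mul (by norm_num) hB0.ne',
        Real.log_div (by positivity) hN.ne']
      ring
    have e2 : Real.log B ≤ g := Real.log_le_log hB0 (by linarith [Real.exp_pos 1])
    have e3 : 0 ≤ Real.log a := Real.log_nonneg (by linarith)
    have e4 : Real.log 16 ≤ 4 := by
      rw [show (16 : ℝ) = 2 ^ 4 by norm_num, Real.log_pow]
      have := Real.log_two_lt_d9
      push_cast
      linarith
    have e5 : 1 ≤ l * g := by nlinarith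
    have e6 : g ≤ l * g := le_mul_of_one_le_left (by linarith) hℓ
    have e7 : l ≤ l * g := le_mul_of_one_le_right (by linarith) hg1
    linarith
  have h2 : 16 * l * g ≤ 1 / (64 * L) * n := by
    calc 16 * l * g = 1 / (64 * L) * (1024 * (L * l * g)) := by field_simp; norm_num
      _ ≤ _ := mul_le_mul_of_nonneg_left hn (by positivity)
  have h3 : Real.exp (-(1 / (64 * L) * n)) ≤ (16 * B / N)⁻¹ := by
    rw [← Real.exp_log (by positivity : 0 < (16 * B / N)⁻¹), Real.log_inv]
    exact Real.exp_le_exp.2 (neg_le_neg (h1.trans h2))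
  calc _ ≤ B * (2 * (16 * B / N)⁻¹) := by gcongr
    _ = N / 4 / 2 := by field_simp; norm_num

end ParameterBounds

/-! ### The high-probability gap bound -/

section HighProbability

variable {S : Type u} {A : Type v} [Fintype S] [DecidableEq S] [Fintype A]

lemma missWeight_le_of_mixing [Nonempty A] (M : MDP S A) (π : Policy S A) {C ρ νmin : ℝ}
    (hC : 0 < C) (hρ0 : 0 < ρ) (hρ1 : ρ < 1) (hν : 0 < νmin) (hmix : IsMixing M C ρ νmin π)
    (n : ℕ) (z z₀ : S × A) (hz : threshold M.γ (Fintype.card A) ≤ (π z.1 z.2).toReal) :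
    missWeight M π z n z₀ ≤
      2 * Real.exp (-(1 / (64 * horizonFactor M.γ C ρ νmin (Fintype.card A)) * n)) := by
  classical
  have hγ := one_sub_γ_pos M
  have ha : (0 : ℝ) < Fintype.card A := by exact_mod_cast Fintype.card_pos
  have hT := mixTime_pos M.γ C ρ νmin (Fintype.card A)
  have hmixT := mul_pow_mixTime_le M.γ_pos M.γ_lt_one hC hρ0 hρ1 hν
    (Fintype.card_pos (α := A))
  have hB := inv_le_horizonFactor (C := C) (ρ := ρ) (a := Fintype.card A) M.γ_lt_one hν
  have hL := horizonFactor_pos (C := C) (ρ := ρ) (a := Fintype.card A) M.γ_lt_one hν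
  have hLdef : horizonFactor M.γ C ρ νmin (Fintype.card A) = 1 / (1 - M.γ) +
    mixTime M.γ C ρ νmin (Fintype.card A) * Fintype.card A / (νmin * (1 - M.γ) ^ 2) := rfl
  set T := mixTime M.γ C ρ νmin (Fintype.card A)
  set L := horizonFactor M.γ C ρ νmin (Fintype.card A)
  have hτ0 : 0 < threshold M.γ (Fintype.card A) := by
    rw [threshold]
    positivity
  have hν1 : νmin ≤ 1 := by
    obtain ⟨ν, -, -, h⟩ := hmix
    exact (h z.1).trans (toReal_le_one ν z.1)
  have hτ1 := hz.trans (toReal_le_one _ _)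
  -- After T steps the state mass is at least νmin/2, hence p = νmin τ/2 = νmin(1-γ)²/(32|A|); half
  -- of it gives the 64 in the rate.
  refine missWeight_le_exp M π z T (νmin / 2 * threshold M.γ (Fintype.card A)) _ hT
    (by positivity) (by nlinarith) (by positivity) ?_ ?_ ?_ n z₀
  · rw [div_le_iff₀ (by positivity)]
    have : 1 ≤ (1 - M.γ) * L := by
      rw [div_le_iff₀ hγ] at hB
      linarith
    linarith
  · have h1 : T * Fintype.card A / (νmin * (1 - M.γ) ^ 2) ≤ L := by
      rw [hLdef]
      have : 0 < 1 / (1 - M.γ) := by positivity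
      linarith
    rw [div_le_iff₀ (by positivity)] at h1
    rw [threshold, div_mul_eq_mul_div, one_mul, div_le_iff₀ (by positivity)]
    calc (T : ℝ) ≤ L * (νmin * (1 - M.γ) ^ 2) / Fintype.card A := by
          rwa [le_div_iff₀ ha]
      _ = _ := by
          field_simp
          norm_num
  · intro z₀
    have h1 := mixing_hit M π C ρ νmin hmix (T - 1) z z₀
    rw [Nat.sub_add_cancel hT] at h1
    refine le_trans ?_ h1
    exact mul_le_mul (by linarith) hz hτ0.le (by linarith)

/-- On a run with accurate batches, the best iterate satisfies the gap bound. -/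
lemma mem_gapEvent_of_accurate [Nontrivial A] (M : MDP S A) (πs : Policy S A)
    (hopt : IsOptimal M πs) {k m n : ℕ} (hk : 0 < k) (h : List (Batch S A m n))
    (hlen : h.length = k)
    (hacc : h ∉ badRun M (stepsize M.γ (Fintype.card A) k) (threshold M.γ (Fintype.card A))
      fun π b => Accurate M π (threshold M.γ (Fintype.card A))
        (noiseLevel M.γ (Fintype.card A) k / 4) b) :
    h ∈ gapEvent M (stepsize M.γ (Fintype.card A) k) (threshold M.γ (Fintype.card A)) k πs
      (12 * (1 / (1 - M.γ)) / (1 - M.γ) * √((Fintype.card A : ℝ) ^ (3 / 2 : ℝ) / k)) := by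
  have ha : 2 ≤ Fintype.card A := Fintype.one_lt_card
  have hN := noiseLevel_pos M.γ_lt_one ha hk
  have hη := stepsize_pos M.γ_lt_one ha hk
  have hbudget := regret_budget M.γ_lt_one ha hk
  have hrate := regret_rate M.γ_lt_one ha hk
  set η := stepsize M.γ (Fintype.card A) k
  set τ := threshold M.γ (Fintype.card A) with hτ
  set N := noiseLevel M.γ (Fintype.card A) k
  let π (t : ℕ) : Policy S A := policyAfter M η τ (h.take t)
  let Qh (t : ℕ) (s : S) (a : A) : ℝ := if ht : t < h.length then tomc M τ (π t) h[t] s a else 0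
  have hQh (t : ℕ) (ht : t < k) (s : S) : Qh t s = tomc M τ (π t) (h[t]'(hlen ▸ ht)) s := by
    funext a
    simp only [Qh]
    rw [dif_pos]
  simp only [badRun, Set.mem_ofPred_eq, not_exists, not_not] at hacc
  intro ϑ
  refine (iInf_objective_sub_le M πs π η _ hk hη (fun s => sum_gap_le M πs hopt π Qh η (N / 4) k
    hη.le (by positivity) rfl ?_ ?_ ?_ ?_ ?_ hbudget s) ϑ).trans hrate
  · intro t ht s
    rw [hQh t ht]
    simp only [π]
    rw [List.take_add_one, List.getElem?_eq_getElem (hlen ▸ ht), Option.toList_some,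
      policyAfter_append]
  · intro t ht s a
    rw [hQh t ht]
    exact tomc_nonneg M τ _ _ s a
  · intro t ht s a
    rw [hQh t ht]
    exact tomc_le M τ _ _ s a
  · intro t ht s a hsa
    rw [hQh t ht, tomc, if_pos hsa]
    exact hacc t (hlen ▸ ht) s a hsa
  · intro t ht s a hsa
    rw [hQh t ht, tomc, if_neg (not_le.2 hsa)]

lemma nonempty_of_uniformlyMixing [Nonempty A] (M : MDP S A) (η τ : ℝ) {k m n : ℕ}
    (init : List (Batch S A m n) → PMF (Fin m → S × A)) {C ρ νmin : ℝ}
    (hmix : UniformlyMixing M η τ init k C ρ νmin) : Nonempty S := by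
  obtain ⟨h, hh⟩ := (runLaw M η τ init k).support_nonempty
  obtain ⟨ν, -⟩ := hmix h hh 0 (Nat.zero_le k)
  exact ν.support_nonempty.to_type

theorem highProbability_gap [Nontrivial A] (M : MDP S A) (C ρ νmin δ : ℝ) (k m n : ℕ)
    (init : List (Batch S A m n) → PMF (Fin m → S × A)) (πs : Policy S A)
    (hC : 0 < C) (hρ0 : 0 < ρ) (hρ1 : ρ < 1) (hν : 0 < νmin) (hδ0 : 0 < δ) (hδ1 : δ < 1)
    (hk : 0 < k) (hm : 0 < m)
    (hmscale : 1024 * mScale M.γ δ (Fintype.card S) (Fintype.card A) k ≤ m)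
    (hnscale : 1024 * polylog 1 (nScale M.γ C ρ νmin (Fintype.card A) k) ≤ n)
    (hmix : UniformlyMixing M (stepsize M.γ (Fintype.card A) k)
      (threshold M.γ (Fintype.card A)) init k C ρ νmin)
    (hopt : IsOptimal M πs) :
    ENNReal.ofReal (1 - δ) ≤ (runLaw M (stepsize M.γ (Fintype.card A) k)
        (threshold M.γ (Fintype.card A)) init k).toOuterMeasure
      (gapEvent M (stepsize M.γ (Fintype.card A) k) (threshold M.γ (Fintype.card A)) k πs
        (12 * (1 / (1 - M.γ)) / (1 - M.γ) * √((Fintype.card A : ℝ) ^ (3 / 2 : ℝ) / k))) := by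
  have hSne := nonempty_of_uniformlyMixing M _ _ init hmix
  have ha : 2 ≤ Fintype.card A := Fintype.one_lt_card
  have hk' : (0 : ℝ) < k := by exact_mod_cast hk
  have hγ := one_sub_γ_pos M
  rcases le_or_gt (k : ℝ) (144 * (1 / (1 - M.γ)) ^ 2 * (Fintype.card A : ℝ) ^ (3 / 2 : ℝ))
    with hsmall | hlarge
  · have hrate := le_rate_of_small M.γ_lt_one hk hsmall
    have huniv : gapEvent M (stepsize M.γ (Fintype.card A) k) (threshold M.γ (Fintype.card A))
        (m := m) (n := n) k πs (12 * (1 / (1 - M.γ)) / (1 - M.γ) *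
          √((Fintype.card A : ℝ) ^ (3 / 2 : ℝ) / k)) = Set.univ := by
      refine Set.eq_univ_of_forall fun h ϑ => ?_
      have h1 := iInf_objective_le M ϑ (fun t : Fin k => policyAfter M
        (stepsize M.γ (Fintype.card A) k) (threshold M.γ (Fintype.card A)) (h.take t)) ⟨0, hk⟩
      have h2 := objective_le M ϑ (policyAfter M
        (stepsize M.γ (Fintype.card A) k) (threshold M.γ (Fintype.card A)) (h.take 0))
      have h3 := objective_nonneg M ϑ πs
      linarith
    rw [huniv, toOuterMeasure_univ]
    exact ENNReal.ofReal_le_one.2 (by linarith)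
  · have hN := noiseLevel_pos M.γ_lt_one ha hk
    have hN8 := noiseLevel_le_of_large M.γ_lt_one ha hk hlarge.le
    have hm1 := sample_size_suffices M.γ_lt_one ha hk (Fintype.card_pos (α := S)) hδ0 hδ1 hmscale
    have hn1 := length_suffices M.γ_lt_one ha hk hν hN8 hnscale
    have hB1 : 1 ≤ 1 / (1 - M.γ) := by
      rw [le_div_iff₀ hγ]; linarith [M.γ_pos]
    set η := stepsize M.γ (Fintype.card A) k
    set τ := threshold M.γ (Fintype.card A)
    have hbad := toOuterMeasure_badRun_le M η τ init (fun π b => Accurate M π τ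
      (noiseLevel M.γ (Fintype.card A) k / 4) b) (ENNReal.ofReal (δ / k)) k (by
        intro i hi h hh
        have hmix' : IsMixing M C ρ νmin (policyAfter M η τ h) := by
          obtain ⟨h', hh', he⟩ := exists_extension_mem_support_runLaw M η τ init i (k - i) h hh
          rw [Nat.add_sub_cancel' hi.le] at hh'
          rw [← he]
          exact hmix h' hh' i hi.le
        rw [toOuterMeasure_eq_ofReal_expect, expect_bind]
        refine ENNReal.ofReal_le_ofReal (expect_le _ fun z₀ => ?_)
        refine (expect_batchLaw_not_accurate_le M _ τ _ m n hm (by positivity)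
          (by rw [show 2 / (1 - M.γ) = 2 * (1 / (1 - M.γ)) by ring]; linarith)
          (fun z z₀ hz => ?_) z₀).trans hm1
        exact (mul_le_mul_of_nonneg_left (missWeight_le_of_mixing M _ hC hρ0 hρ1 hν hmix' n z z₀
          hz) (by positivity)).trans hn1)
    have hkδ : (k : ENNReal) * ENNReal.ofReal (δ / k) = ENNReal.ofReal δ := by
      rw [← ENNReal.ofReal_natCast, ← ENNReal.ofReal_mul hk'.le, mul_div_cancel₀ _ hk'.ne']
    rw [hkδ] at hbad
    rw [ENNReal.ofReal_sub _ hδ0.le, ENNReal.ofReal_one]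
    exact one_sub_le_toOuterMeasure _ _ _ _ hbad fun h hh hnot =>
      mem_gapEvent_of_accurate M πs hopt hk h (length_of_mem_support_runLaw M η τ init k h hh) hnot

end HighProbability

/-! ### Sample complexity -/

section SampleCount

lemma rpow_seven_halves {a : ℝ} (ha : 0 ≤ a) : a ^ (7 / 2 : ℝ) = a ^ 3 * √a := by
  rw [Real.sqrt_eq_rpow, show (7 / 2 : ℝ) = (3 : ℕ) + 1 / 2 by norm_num,
    Real.rpow_add_of_nonneg ha (by positivity) (by norm_num), Real.rpow_natCast]

variable {γ ε δ C ρ νmin : ℝ} {a k cS : ℕ}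

lemma iterationCount_ge (hγ0 : 0 < γ) (hγ1 : γ < 1) (hε0 : 0 < ε) (hε1 : ε ≤ 1) :
    144 * (1 / (1 - γ)) ^ 2 * (a : ℝ) ^ (3 / 2 : ℝ) ≤ iterationCount γ ε a := by
  have hγ : 0 < 1 - γ := by linarith
  refine le_trans ?_ (Nat.le_ceil _)
  rw [le_div_iff₀ (by positivity)]
  have h1 : (1 - γ) ^ 2 * ε ^ 2 ≤ 1 * 1 :=
    mul_le_mul (pow_le_one₀ hγ.le (by linarith)) (pow_le_one₀ hε0.le hε1) (by positivity)
      zero_le_one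
  have h2 : 0 ≤ 144 * (a : ℝ) ^ (3 / 2 : ℝ) := by positivity
  calc _ = 144 * (a : ℝ) ^ (3 / 2 : ℝ) * ((1 - γ) ^ 2 * ε ^ 2) := by field_simp
    _ ≤ _ := mul_le_of_le_one_right h2 (by linarith)

lemma rate_iterationCount_le (hγ1 : γ < 1) (ha : 2 ≤ a) (hε0 : 0 < ε) :
    12 * (1 / (1 - γ)) / (1 - γ) * √((a : ℝ) ^ (3 / 2 : ℝ) / iterationCount γ ε a) ≤ ε := by
  have hγ : 0 < 1 - γ := by linarith
  have ha' : (2 : ℝ) ≤ a := by exact_mod_cast ha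
  have hk : 144 * (a : ℝ) ^ (3 / 2 : ℝ) / ((1 - γ) ^ 4 * ε ^ 2) ≤ iterationCount γ ε a :=
    Nat.le_ceil _
  have hk0 : 0 < (iterationCount γ ε a : ℝ) := lt_of_lt_of_le (by positivity) hk
  rw [div_le_iff₀ (by positivity)] at hk
  rw [← pow_le_pow_iff_left₀ (by positivity) hε0.le two_ne_zero, mul_pow,
    Real.sq_sqrt (by positivity), mul_div_assoc', div_le_iff₀ hk0]
  field_simp
  nlinarith

lemma mScale_eq (ha : 2 ≤ a) (hγ1 : γ < 1) (hk : 0 < k) :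
    mScale γ δ cS a k = a / (2 * (√a - 1)) * k * Real.log (2 * (cS * a) * k / δ) := by
  have hγ : 0 < 1 - γ := by linarith
  have ha' : (2 : ℝ) ≤ a := by exact_mod_cast ha
  have hk' : (0 : ℝ) < k := by exact_mod_cast hk
  have hR : 0 < √(a : ℝ) - 1 := by
    rw [sub_pos, Real.lt_sqrt] <;> linarith
  rw [mScale, noiseLevel_sq ha]
  congr 1
  field_simp

lemma one_lt_two_mul_card_div (ha : 2 ≤ a) (hk : 0 < k) (hS : 0 < cS) (hδ0 : 0 < δ)
    (hδ1 : δ < 1) : 1 < 2 * ((cS : ℝ) * a) * k / δ := by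
  have ha' : (2 : ℝ) ≤ a := by exact_mod_cast ha
  have hk' : (1 : ℝ) ≤ k := by exact_mod_cast hk
  have hS' : (1 : ℝ) ≤ cS := by exact_mod_cast hS
  rw [lt_div_iff₀ hδ0]
  have h1 : (1 : ℝ) * 1 ≤ cS * a := by gcongr; linarith
  have h2 : (1 : ℝ) * 1 ≤ (cS * a) * k := by gcongr; linarith
  linarith

lemma mScale_pos (ha : 2 ≤ a) (hγ1 : γ < 1) (hk : 0 < k) (hS : 0 < cS) (hδ0 : 0 < δ)
    (hδ1 : δ < 1) : 0 < mScale γ δ cS a k := by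
  have ha' : (2 : ℝ) ≤ a := by exact_mod_cast ha
  have hk' : (0 : ℝ) < k := by exact_mod_cast hk
  have hR : 0 < √(a : ℝ) - 1 := by
    rw [sub_pos, Real.lt_sqrt] <;> linarith
  have := Real.log_pos (one_lt_two_mul_card_div ha hk hS hδ0 hδ1)
  rw [mScale_eq ha hγ1 hk]
  positivity

/-- Equivalent to √a ≥ 4/3, true for a ≥ 2. So m is of order √a · k up to a logarithm. -/
lemma card_div_sqrt_sub_one_le (ha : 2 ≤ a) : (a : ℝ) / (2 * (√a - 1)) ≤ 2 * √a := by
  have ha' : (2 : ℝ) ≤ a := by exact_mod_cast ha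
  have hR : 4 / 3 ≤ √(a : ℝ) := by
    rw [Real.le_sqrt] <;> linarith
  have hsq := Real.sq_sqrt (by linarith : (0 : ℝ) ≤ a)
  rw [div_le_iff₀ (by linarith)]
  nlinarith

lemma log_card_div_noiseLevel_le (hγ0 : 0 < γ) (hγ1 : γ < 1) (ha : 2 ≤ a) (hk : 0 < k) {Y : ℝ}
    (hY : (k : ℝ) ≤ 2 * Y) (hε0 : 0 < ε)
    (hYdef : Y = 144 * (a * √a) / ((1 - γ) ^ 4 * ε ^ 2)) :
    Real.log (a / noiseLevel γ a k) ≤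
      Real.log 24 + Real.log (a / ε) + 2 * Real.log (1 / (1 - γ)) := by
  have hγ : 0 < 1 - γ := by linarith
  have ha' : (2 : ℝ) ≤ a := by exact_mod_cast ha
  have hk' : (0 : ℝ) < k := by exact_mod_cast hk
  have hN := noiseLevel_pos hγ1 ha hk
  have hR : 0 < √(a : ℝ) - 1 := by
    rw [sub_pos, Real.lt_sqrt] <;> linarith
  have hsq := Real.sq_sqrt (by linarith : (0 : ℝ) ≤ a)
  have h1 : a / noiseLevel γ a k ≤ 24 * (a / ε) * (1 / (1 - γ)) ^ 2 := by
    rw [← pow_le_pow_iff_left₀ (by positivity) (by positivity) two_ne_zero, div_pow,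
      noiseLevel_sq ha]
    calc _ = (1 - γ) ^ 2 * (a / (2 * (√a - 1)) * k) := by field_simp
      _ ≤ 1 * (2 * √a * (2 * Y)) := by
          refine mul_le_mul (pow_le_one₀ hγ.le (by linarith)) ?_ (by positivity) zero_le_one
          exact mul_le_mul (card_div_sqrt_sub_one_le ha) hY hk'.le (by positivity)
      _ = 576 * (a * √a ^ 2) / ((1 - γ) ^ 4 * ε ^ 2) := by rw [hYdef]; ring
      _ = _ := by rw [hsq]; field_simp; norm_num
  calc _ ≤ Real.log (24 * (a / ε) * (1 / (1 - γ)) ^ 2) := Real.log_le_log (by positivity) h1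
    _ = _ := by
      rw [Real.log_mul (by positivity) (by positivity), Real.log_mul (by norm_num) (by positivity),
        Real.log_pow]
      norm_num

lemma nat_ceil_le_mul {x c : ℝ} (hx : 0 ≤ x) (hc : 1 ≤ c) (hxc : x ≤ c) : (⌈x⌉₊ : ℝ) ≤ 2 * c := by
  linarith [Nat.ceil_lt_add_one hx]

lemma iterationCount_le {Y : ℝ} (hγ0 : 0 < γ) (hγ1 : γ < 1) (ha : 2 ≤ a) (hε0 : 0 < ε)
    (hε1 : ε ≤ 1) (hYdef : Y = 144 * (a * √a) / ((1 - γ) ^ 4 * ε ^ 2)) :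
    (iterationCount γ ε a : ℝ) ≤ 2 * Y ∧ 144 ≤ Y := by
  have hγ : 0 < 1 - γ := by linarith
  have ha' : (2 : ℝ) ≤ a := by exact_mod_cast ha
  have hR : 1 ≤ √(a : ℝ) := Real.one_le_sqrt.2 (by linarith)
  have hY : 144 ≤ Y := by
    rw [hYdef, le_div_iff₀ (by positivity)]
    have h1 : (1 - γ) ^ 4 * ε ^ 2 ≤ 1 * 1 :=
      mul_le_mul (pow_le_one₀ hγ.le (by linarith)) (pow_le_one₀ hε0.le hε1) (by positivity)
        zero_le_one
    nlinarith
  refine ⟨?_, hY⟩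
  rw [iterationCount, rpow_three_halves (Nat.cast_nonneg a), ← hYdef]
  exact nat_ceil_le_mul (by linarith) (by linarith) le_rfl

lemma polylog_pos {q : ℕ} {x : ℝ} (hx : 0 < x) : 0 < polylog q x :=
  mul_pos hx (pow_pos (by linarith [one_le_log_exp_add hx.le]) q)

/-- As G ≤ e + F, the argument is at most 9(e + F)², and the logarithm turns the square into a
constant factor. -/
lemma log_exp_add_le {x F G : ℝ} (hx : 0 ≤ x) (hF : 0 ≤ F) (hG : G = Real.log (Real.exp 1 + F))
    (h : x ≤ 9 * F * G) : Real.log (Real.exp 1 + x) ≤ 5 * G := by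
  have he := Real.exp_pos 1
  have he1 : 1 ≤ Real.exp 1 := Real.one_le_exp zero_le_one
  have hG1 : 1 ≤ G := hG ▸ one_le_log_exp_add hF
  have hGF : G ≤ Real.exp 1 + F := by
    have := Real.log_le_sub_one_of_pos (by positivity : 0 < Real.exp 1 + F)
    linarith
  have h1 : Real.exp 1 + x ≤ 9 * (Real.exp 1 + F) ^ 2 := by nlinarith
  have h2 : Real.log 9 ≤ 3 := by
    rw [Real.log_le_iff_le_exp (by norm_num), show (3 : ℝ) = (3 : ℕ) * 1 by norm_num,
      Real.exp_nat_mul]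
    have := pow_le_pow_left₀ (by norm_num) Real.exp_one_gt_d9.le 3
    norm_num at this ⊢
    linarith
  calc _ ≤ Real.log (9 * (Real.exp 1 + F) ^ 2) := Real.log_le_log (by positivity) h1
    _ = Real.log 9 + 2 * G := by
      rw [Real.log_mul (by norm_num) (by positivity), Real.log_pow, hG]
      norm_num
    _ ≤ 5 * G := by linarith

lemma ceil_length_le {L l lam F G : ℝ} (hL : 1 ≤ L) (hl : 1 ≤ l) (hlam : 0.69 ≤ lam)
    (hF : L * lam ≤ F) (hG : G = Real.log (Real.exp 1 + F)) (hl9 : l ≤ 9 * lam * G) :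
    (⌈1024 * polylog 1 (L * l)⌉₊ : ℝ) ≤ 2 * (46080 * (L * lam * G ^ 2)) := by
  have hx0 : 0 < L * l := by positivity
  have hF0 : 0 ≤ F := le_trans (by positivity) hF
  have hG1 : 1 ≤ G := hG ▸ one_le_log_exp_add hF0
  have hx : L * l ≤ 9 * (L * lam) * G := by
    calc L * l ≤ L * (9 * lam * G) := by gcongr
      _ = _ := by ring
  have hlog : Real.log (Real.exp 1 + L * l) ≤ 5 * G := by
    refine log_exp_add_le hx0.le hF0 hG (hx.trans ?_)
    gcongr
  refine nat_ceil_le_mul (mul_nonneg (by norm_num) (polylog_pos hx0).le) ?_ ?_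
  · have h1 : (1 : ℝ) * 0.69 * 1 ≤ L * lam * G ^ 2 := by
      gcongr
      exact one_le_pow₀ hG1
    linarith
  · rw [polylog, pow_one]
    have h1 : L * l * Real.log (Real.exp 1 + L * l) ≤ 9 * (L * lam) * G * (5 * G) :=
      mul_le_mul hx hlog (by linarith [one_le_log_exp_add hx0.le]) (by positivity)
    linarith

lemma ceil_mScale_le {Z : ℝ} (hγ1 : γ < 1) (ha : 2 ≤ a) (hk : 0 < k) (hS : 0 < cS) (hδ0 : 0 < δ)
    (hδ1 : δ < 1) (hZ : 8 ≤ Z) (hX : 2 * ((cS : ℝ) * a) * k / δ ≤ 2 * Z) :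
    (⌈1024 * mScale γ δ cS a k⌉₊ : ℝ) ≤ 2 * (4096 * (√a * k * Real.log Z)) := by
  have ha' : (2 : ℝ) ≤ a := by exact_mod_cast ha
  have hk' : (1 : ℝ) ≤ k := by exact_mod_cast hk
  have hR : 1 ≤ √(a : ℝ) := Real.one_le_sqrt.2 (by linarith)
  have hX1 := one_lt_two_mul_card_div (δ := δ) ha hk hS hδ0 hδ1
  have hlZ : 1 ≤ Real.log Z := by
    rw [Real.le_log_iff_exp_le (by linarith)]
    linarith [Real.exp_one_lt_d9]
  refine nat_ceil_le_mul (mul_nonneg (by norm_num) (mScale_pos ha hγ1 hk hS hδ0 hδ1).le) ?_ ?_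
  · have h1 : (1 : ℝ) * 1 * 1 ≤ √a * k * Real.log Z := by gcongr
    linarith
  · have h1 : Real.log (2 * ((cS : ℝ) * a) * k / δ) ≤ 2 * Real.log Z := by
      calc _ ≤ Real.log (Z ^ 2) := Real.log_le_log (by linarith) (by nlinarith)
        _ = 2 * Real.log Z := by rw [Real.log_pow]; norm_num
    rw [mScale_eq ha hγ1 hk]
    have h3 : a / (2 * (√a - 1)) * k * Real.log (2 * (cS * a) * k / δ) ≤
        2 * √a * k * (2 * Real.log Z) :=
      mul_le_mul (mul_le_mul_of_nonneg_right (card_div_sqrt_sub_one_le ha) (by positivity)) h1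
        (Real.log_pos hX1).le (by positivity)
    linarith

lemma sample_count_le {m n : ℕ} (hγ0 : 0 < γ) (hγ1 : γ < 1) (ha : 2 ≤ a) (hS : 0 < cS)
    (hδ0 : 0 < δ) (hδ1 : δ < 1) (hε0 : 0 < ε) (hε1 : ε ≤ 1) (hν : 0 < νmin)
    (hk : k = iterationCount γ ε a) (hm : m = ⌈1024 * mScale γ δ cS a k⌉₊)
    (hn : n = ⌈1024 * polylog 1 (nScale γ C ρ νmin a k)⌉₊) :
    ((k * m * n : ℕ) : ℝ) ≤ 10 ^ 14 * polylog 2 (sampleScale γ δ ε C ρ νmin cS a) := by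
  have hγ : 0 < 1 - γ := by linarith
  have ha' : (2 : ℝ) ≤ a := by exact_mod_cast ha
  have hS' : (1 : ℝ) ≤ cS := by exact_mod_cast hS
  have hR : 1 ≤ √(a : ℝ) := Real.one_le_sqrt.2 (by linarith)
  have hsq := Real.sq_sqrt (by linarith : (0 : ℝ) ≤ a)
  obtain ⟨Y, hY⟩ : ∃ Y : ℝ, Y = 144 * (a * √a) / ((1 - γ) ^ 4 * ε ^ 2) := ⟨_, rfl⟩
  obtain ⟨hk2, hY144⟩ := iterationCount_le hγ0 hγ1 ha hε0 hε1 hY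
  have hlarge := iterationCount_ge (a := a) hγ0 hγ1 hε0 hε1
  rw [← hk] at hk2 hlarge
  have hk0 : 0 < k := by
    have h1 : 0 < 144 * (1 / (1 - γ)) ^ 2 * (a : ℝ) ^ (3 / 2 : ℝ) := by positivity
    exact_mod_cast h1.trans_le hlarge
  have hk' : (1 : ℝ) ≤ k := by exact_mod_cast hk0
  have hL := horizonFactor_pos (C := C) (ρ := ρ) (a := a) hγ1 hν
  have hBL := inv_le_horizonFactor (C := C) (ρ := ρ) (a := a) hγ1 hν
  have hB1 : 1 ≤ 1 / (1 - γ) := by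
    rw [le_div_iff₀ hγ]; linarith
  have hℓ1 := one_le_log_of_large hγ1 ha hk0 (noiseLevel_le_of_large hγ1 ha hk0 hlarge)
  have hℓ := log_card_div_noiseLevel_le hγ0 hγ1 ha hk0 hk2 hε0 hY
  set L := horizonFactor γ C ρ νmin a
  have hns : nScale γ C ρ νmin a k = L * Real.log (a / noiseLevel γ a k) := rfl
  set l := Real.log (a / noiseLevel γ a k)
  obtain ⟨Z, hZ⟩ : ∃ Z : ℝ, Z = 2 * (cS * a) * Y / δ := ⟨_, rfl⟩
  obtain ⟨lZ, hlZ⟩ : ∃ x : ℝ, x = Real.log Z := ⟨_, rfl⟩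
  obtain ⟨lam, hlam⟩ : ∃ x : ℝ, x = Real.log (a / ε) := ⟨_, rfl⟩
  obtain ⟨A₀, hA₀⟩ : ∃ x : ℝ, x = a ^ 3 * √a / ((1 - γ) ^ 8 * ε ^ 4) := ⟨_, rfl⟩
  have hF : sampleScale γ δ ε C ρ νmin cS a = A₀ * L * lZ * lam := by
    rw [sampleScale, rpow_seven_halves (Nat.cast_nonneg a), ← hA₀, ← hlam,
      rpow_three_halves (Nat.cast_nonneg a), hlZ, hZ, hY]
    congr 3
    field_simp
    norm_num
  have hlog2 := Real.log_two_gt_d9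
  have hZ8 : 8 ≤ Z := by
    rw [hZ, le_div_iff₀ hδ0]
    have h1 : (1 : ℝ) * 2 ≤ cS * a := by gcongr
    have h2 : (2 : ℝ) * 144 ≤ (cS * a) * Y := by gcongr; linarith
    linarith
  have hlZ1 : 2 ≤ lZ := by
    have h1 : Real.log (2 ^ 3) ≤ lZ := hlZ ▸ Real.log_le_log (by norm_num) (by linarith)
    rw [Real.log_pow] at h1
    push_cast at h1
    linarith
  have hlam1 : Real.log 2 ≤ lam := by
    rw [hlam]
    refine Real.log_le_log (by norm_num) ?_
    rw [le_div_iff₀ hε0]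
    nlinarith
  have hlam0 : 0.69 ≤ lam := by linarith
  have hA8 : 8 ≤ A₀ := by
    rw [hA₀, le_div_iff₀ (by positivity)]
    have h1 : (1 - γ) ^ 8 * ε ^ 4 ≤ 1 * 1 :=
      mul_le_mul (pow_le_one₀ hγ.le (by linarith)) (pow_le_one₀ hε0.le hε1) (by positivity)
        zero_le_one
    have h2 : (2 : ℝ) ^ 3 * 1 ≤ a ^ 3 * √a := by gcongr
    linarith
  have hRY : √a * Y ^ 2 = 20736 * A₀ := by
    rw [hY, hA₀]
    field_simp
    rw [hsq]
    ring
  clear_value L l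
  generalize sampleScale γ δ ε C ρ νmin cS a = F at hF ⊢
  have hLl1 : L * lam ≤ F := by
    have h1 : (8 : ℝ) * 2 ≤ A₀ * lZ := by gcongr
    replace h1 : 1 ≤ A₀ * lZ := by linarith
    calc L * lam = 1 * (L * lam) := (one_mul _).symm
      _ ≤ A₀ * lZ * (L * lam) := by gcongr
      _ = F := by rw [hF]; ring
  have hLF : L ≤ F := by
    have h1 : (8 : ℝ) * 2 * 0.69 ≤ A₀ * lZ * lam := by gcongr
    replace h1 : 1 ≤ A₀ * lZ * lam := by linarith
    calc L = 1 * L := (one_mul _).symm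
      _ ≤ A₀ * lZ * lam * L := by gcongr
      _ = F := by rw [hF]; ring
  have hF0 : 0 < F := hL.trans_le hLF
  obtain ⟨G, hG⟩ : ∃ x : ℝ, x = Real.log (Real.exp 1 + F) := ⟨_, rfl⟩
  have hG1 : 1 ≤ G := hG ▸ one_le_log_exp_add hF0.le
  -- log(1/(1-γ)) is absorbed in G through 1/(1-γ) ≤ L ≤ F. This is one of the two powers of G; the
  -- other comes from the logarithm in the trajectory length.
  have hl9 : l ≤ 9 * lam * G := by
    have h1 : Real.log 24 ≤ 5 * Real.log 2 := by
      rw [← Nat.cast_ofNat (n := 5), ← Real.log_pow]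
      exact Real.log_le_log (by norm_num) (by norm_num)
    have h2 : Real.log (1 / (1 - γ)) ≤ G := by
      rw [hG]
      exact Real.log_le_log (by positivity) (by linarith [Real.exp_pos 1])
    rw [← hlam] at hℓ
    have h3 : lam ≤ lam * G := le_mul_of_one_le_right (by linarith) hG1
    have h4 : 0.69 * G ≤ lam * G := by gcongr
    linarith
  have hn' : (n : ℝ) ≤ 2 * (46080 * (L * lam * G ^ 2)) := by
    rw [hn, hns]
    exact ceil_length_le (hB1.trans hBL) hℓ1 hlam0 hLl1 hG hl9
  have hm' : (m : ℝ) ≤ 2 * (4096 * (√a * k * lZ)) := by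
    rw [hm, hlZ]
    refine ceil_mScale_le hγ1 ha hk0 hS hδ0 hδ1 hZ8 ?_
    rw [hZ, mul_div_assoc']
    refine div_le_div_of_nonneg_right ?_ hδ0.le
    calc 2 * ((cS : ℝ) * a) * k ≤ 2 * ((cS : ℝ) * a) * (2 * Y) := by gcongr
      _ = _ := by ring
  -- One k is the iteration count, the other comes from m; k ≤ 2Y and 20736 = 144².
  have hkk : √a * k * k ≤ 4 * 20736 * A₀ := by
    calc √a * k * k ≤ √a * (2 * Y) * (2 * Y) := by gcongr
      _ = 4 * (√a * Y ^ 2) := by ring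
      _ = _ := by rw [hRY]; ring
  rw [polylog, ← hG, hF]
  push_cast
  calc (k : ℝ) * m * n ≤ k * (2 * (4096 * (√a * k * lZ))) * (2 * (46080 * (L * lam * G ^ 2))) := by
        gcongr
    _ = 4 * 4096 * 46080 * (lZ * (L * lam * G ^ 2)) * (√a * k * k) := by ring
    _ ≤ 4 * 4096 * 46080 * (lZ * (L * lam * G ^ 2)) * (4 * 20736 * A₀) := by gcongr
    _ = 4 * 4096 * 46080 * 4 * 20736 * (A₀ * L * lZ * lam * G ^ 2) := by ring
    _ ≤ 10 ^ 14 * (A₀ * L * lZ * lam * G ^ 2) := by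
        refine mul_le_mul_of_nonneg_right (by norm_num) ?_
        positivity
    _ = _ := by ring

end SampleCount

lemma gapEvent_mono {S : Type u} {A : Type v} [Fintype S] [DecidableEq S] [Fintype A] [Nonempty A]
    (M : MDP S A) (η τ : ℝ) {m n : ℕ} (k : ℕ) (πs : Policy S A) {B B' : ℝ} (h : B ≤ B') :
    gapEvent M η τ (m := m) (n := n) k πs B ⊆ gapEvent M η τ k πs B' :=
  fun _ hx ϑ => (hx ϑ).trans h

end SPMD

end

theorem mainTheorem6 :
    ∃ c₀ : ℝ, 0 < c₀ ∧ ∃ q : ℕ,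
      -- high-probability bound on the gap of the best iterate
      (∀ (S : Type u) (A : Type v) [Fintype S] [DecidableEq S] [Fintype A] [Nontrivial A]
        (M : SPMD.MDP S A) (C ρ νmin δ : ℝ) (k m n : ℕ)
        (init : List (SPMD.Batch S A m n) → PMF (Fin m → S × A)) (πs : SPMD.Policy S A),
        0 < C → 0 < ρ → ρ < 1 → 0 < νmin → 0 < δ → δ < 1 → 0 < k → 0 < m → 0 < n →
        c₀ * SPMD.mScale M.γ δ (Fintype.card S) (Fintype.card A) k ≤ m →
        c₀ * SPMD.polylog q (SPMD.nScale M.γ C ρ νmin (Fintype.card A) k) ≤ n →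
        SPMD.UniformlyMixing M (SPMD.stepsize M.γ (Fintype.card A) k)
          (SPMD.threshold M.γ (Fintype.card A)) init k C ρ νmin →
        SPMD.IsOptimal M πs →
        ENNReal.ofReal (1 - δ) ≤
          (SPMD.runLaw M (SPMD.stepsize M.γ (Fintype.card A) k)
            (SPMD.threshold M.γ (Fintype.card A)) init k).toOuterMeasure
          (SPMD.gapEvent M (SPMD.stepsize M.γ (Fintype.card A) k)
            (SPMD.threshold M.γ (Fintype.card A)) k πs
            (12 * (1 / (1 - M.γ)) / (1 - M.γ) *
              √((Fintype.card A : ℝ) ^ (3 / 2 : ℝ) / k)))) ∧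
      -- sample complexity
      (∃ K : ℝ, 0 < K ∧ ∃ r : ℕ,
        ∀ (S : Type u) (A : Type v) [Fintype S] [DecidableEq S] [Fintype A] [Nontrivial A]
        (M : SPMD.MDP S A) (C ρ νmin δ ε : ℝ) (k m n : ℕ)
        (init : List (SPMD.Batch S A m n) → PMF (Fin m → S × A)) (πs : SPMD.Policy S A),
        0 < C → 0 < ρ → ρ < 1 → 0 < νmin → 0 < δ → δ < 1 → 0 < ε → ε ≤ 1 →
        k = SPMD.iterationCount M.γ ε (Fintype.card A) →
        m = ⌈c₀ * SPMD.mScale M.γ δ (Fintype.card S) (Fintype.card A) k⌉₊ →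
        n = ⌈c₀ * SPMD.polylog q (SPMD.nScale M.γ C ρ νmin (Fintype.card A) k)⌉₊ →
        SPMD.UniformlyMixing M (SPMD.stepsize M.γ (Fintype.card A) k)
          (SPMD.threshold M.γ (Fintype.card A)) init k C ρ νmin →
        SPMD.IsOptimal M πs →
        ENNReal.ofReal (1 - δ) ≤
          (SPMD.runLaw M (SPMD.stepsize M.γ (Fintype.card A) k)
            (SPMD.threshold M.γ (Fintype.card A)) init k).toOuterMeasure
          (SPMD.gapEvent M (SPMD.stepsize M.γ (Fintype.card A) k)
            (SPMD.threshold M.γ (Fintype.card A)) k πs ε) ∧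
        ((k * m * n : ℕ) : ℝ) ≤
          K * SPMD.polylog r
            (SPMD.sampleScale M.γ δ ε C ρ νmin (Fintype.card S) (Fintype.card A))) := by

  refine ⟨1024, by norm_num, 1, ?_, 10 ^ 14, by norm_num, 2, ?_⟩
  · intro S A _ _ _ _ M C ρ νmin δ k m n init πs hC hρ0 hρ1 hν hδ0 hδ1 hk hm _ hms hns hmix hopt
    exact SPMD.highProbability_gap M C ρ νmin δ k m n init πs hC hρ0 hρ1 hν hδ0 hδ1 hk hm hms hns
      hmix hopt
  · intro S A _ _ _ _ M C ρ νmin δ ε k m n init πs hC hρ0 hρ1 hν hδ0 hδ1 hε0 hε1 hk hm hn hmix hopt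
    have hSne := SPMD.nonempty_of_uniformlyMixing M _ _ init hmix
    have ha : 2 ≤ Fintype.card A := Fintype.one_lt_card
    have hγ := SPMD.one_sub_γ_pos M
    refine ⟨?_, SPMD.sample_count_le M.γ_pos M.γ_lt_one ha Fintype.card_pos hδ0 hδ1 hε0 hε1 hν
      hk hm hn⟩
    have hlarge := SPMD.iterationCount_ge (a := Fintype.card A) M.γ_pos M.γ_lt_one hε0 hε1
    have hrate := SPMD.rate_iterationCount_le M.γ_lt_one ha hε0
    rw [← hk] at hlarge hrate
    have hk0 : 0 < k := by
      have h1 : 0 < 144 * (1 / (1 - M.γ)) ^ 2 * (Fintype.card A : ℝ) ^ (3 / 2 : ℝ) := by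
        have : 0 < Fintype.card A := by omega
        positivity
      exact_mod_cast h1.trans_le hlarge
    have hm0 : 0 < m := by
      rw [hm, Nat.ceil_pos]
      exact mul_pos (by norm_num)
        (SPMD.mScale_pos ha M.γ_lt_one hk0 Fintype.card_pos hδ0 hδ1)
    refine (SPMD.highProbability_gap M C ρ νmin δ k m n init πs hC hρ0 hρ1 hν hδ0 hδ1 hk0 hm0
      (hm ▸ Nat.le_ceil _) (hn ▸ Nat.le_ceil _) hmix hopt).trans ?_
    exact MeasureTheory.OuterMeasure.mono _ (SPMD.gapEvent_mono M _ _ k πs hrate)
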